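/- **Setting.** Let $U\subset\mathbb R^3$ be an open box (a product of open intervals) with coordinates $u=(u^1,u^2,u^3)$. All functions of $u$ are real and $C^\infty$ on $U$, and $\partial_k=\partial/\partial u^k$. Differential polynomials are polynomials in the jet variables $u^i_x,u^i_{xx},\dots$ with coefficients functions of $u$, graded by $\deg f(u)=0$, $\deg \frac{d^k u^i}{dx^k}=k$. A bivector of degree $d$ is a matrix differential operator $P=\sum_{s=0}^{d}A_s\frac{d^{d-s}}{dx^{d-s}}$ that is skew-symmetric ($P^*=-P$), the entries of $A_s$ being differential polynomials of degree $s$; $[\cdot,\cdot]$ is the Schouten bracket and $\mathrm{Lie}$ the Lie derivative along evolutionary vector fields. Let $$P^{(3)}_0=\begin{pmatrix}0&u^3_x&0\\-u^3_x&0&0\\0&0&0\end{pmatrix}.$$ A first-order deformation of $P^{(3)}_0$ is a formal series $P_\epsilon=P^{(3)}_0+\epsilon P_1+\epsilon^2P_2+\dots$ of bivectors, $\deg P_k=k+1$, with $[P_\epsilon,P_\epsilon]=\mathcal O(\epsilon^2)$, that is, $[P_0^{(3)},P_0^{(3)}]=0$ and $[P^{(3)}_0,P_1]=0$. The infinitesimal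 Miura transformation given by a vector field $X$ of degree 1, $X^i=\sum_m X^i_m(u)\,u^m_x$, acts by the Lie series of $\epsilon X$, so that $P_1\mapsto P_1+\mathrm{Lie}_XP_0^{(3)}$. **Theorem.** Every first-order deformation of $P^{(3)}_0$ can be reduced by an infinitesimal Miura transformation to $P=P^{(3)}_0+\epsilon P_1+\mathcal O(\epsilon^2)$, where $$P_1=\begin{pmatrix}0&-\alpha^{21}&0\\\alpha^{21}&0&0\\0&0&0\end{pmatrix}\frac{d^2}{dx^2}+\begin{pmatrix}\beta^{11}&\beta^{12}&\beta^{13}\\\beta^{21}&\beta^{22}&\beta^{23}\\\beta^{13}&\beta^{23}&0\end{pmatrix}\frac{d}{dx}+\begin{pmatrix}\gamma^{11}&\gamma^{12}&\gamma^{13}\\\gamma^{21}&\gamma^{22}&\gamma^{23}\\\gamma^{31}&\gamma^{32}&0\end{pmatrix}$$ with $$\alpha^{21}=a,$$ $$\beta^{11}=(2\partial_2a-b^{21}_2-\partial_2s-\partial_2r)u^1_x+b^{11}_2u^2_x,$$ $$\beta^{12}=(\partial_1s-2\partial_1a)u^1_x+(b^{21}_2-2\partial_2a)u^2_x-2\partial_3a\,u^3_x,$$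 $$\beta^{13}=\tfrac{b^{21}_2+\partial_2s+\partial_2r}{2}u^3_x,\qquad \beta^{21}=\partial_1s\,u^1_x+b^{21}_2u^2_x,$$ $$\beta^{22}=b^{22}_1u^1_x+\partial_1r\,u^2_x,\qquad \beta^{23}=-\left(\partial_1s+\tfrac{\partial_1r}{2}\right)u^3_x,$$ $$\begin{aligned}\gamma^{11}={}&\left(\partial_2a-\tfrac{b^{21}_2+\partial_2s+\partial_2r}{2}\right)u^1_{xx}+\left(\partial_1\partial_2a-\tfrac{\partial_1b^{21}_2+\partial_1\partial_2s+\partial_1\partial_2r}{2}\right)(u^1_x)^2\\&+\left(\partial_2\partial_3a-\tfrac{\partial_3b^{21}_2+\partial_2\partial_3s+\partial_2\partial_3r}{2}\right)u^1_xu^3_x+\tfrac{\partial_3b^{11}_2}{2}u^2_xu^3_x+\tfrac{b^{11}_2}{2}u^2_{xx}\\&+\left(\partial_2^2a-\tfrac{\partial_2b^{21}_2+\partial_2^2r+\partial_2^2s-\partial_1b^{11}_2}{2}\right)u^1_xu^2_x+\tfrac{\partial_2b^{11}_2}{2}(u^2_x)^2,\end{aligned}$$ $$\begin{aligned}\ga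mma^{12}={}&\left(\tfrac{\partial_2^2s+\partial_2^2r+3\partial_2b^{21}_2-\partial_1b^{11}_2}{4}-\tfrac{\partial_2^2a}{2}\right)(u^2_x)^2+(\partial_1\partial_3s-2\partial_1\partial_3a)u^1_xu^3_x\\&+\left(\tfrac{3\partial_1b^{21}_2+3\partial_1\partial_2s}{2}+\partial_1\partial_2r-2\partial_1\partial_2a\right)u^1_xu^2_x+(\partial_3b^{21}_2-\partial_2\partial_3a)u^2_xu^3_x\\&+\left(\tfrac{3\partial_1^2s}{2}+\tfrac{\partial_2b^{22}_1+\partial_1^2r}{4}-\partial_1^2a\right)(u^1_x)^2+(b^{21}_2-\partial_2a)u^2_{xx}-\partial_3a\,u^3_{xx}\\&+(\partial_1s-\partial_1a)u^1_{xx}-\partial_3^2a\,(u^3_x)^2,\end{aligned}$$ $$\gamma^{13}=(\partial_2s+\partial_2r)u^3_{xx}+\tfrac{\partial_1b^{21}_2-\partial_1\partial_2s}{2}u^1_xu^3_x+\tfrac{\partial_3b^{21}_2+\partial_2\partial_3s+\partial_2\partial_3r}{2}(u^3_x)^2,$$ $$\begin{aligned}\gamma^{21}={}&\left(\tfrac{\partial_2b^{21}_2+\partial_1b^{11}_2-\partial_2^2s-\partial_2^2r}{4}-\tfrac{\partial_2^2a}{2}\right)(u^2_x)^2-\left(\tfrac{\partial_2b^{22}_1+\partial_1^2r}{4}+\tfrac{\partial_1^2s}{2}\right)(u^1_x)^2\\&-\left(\tfrac{\partial_1b^{21}_2+\partial_1\partial_2s}{2}+\partial_1\partial_2r\right)u^1_xu^2_x-\partial_2\partial_3a\,u^2_xu^3_x,\end{aligned}$$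 $$\begin{aligned}\gamma^{22}={}&\tfrac{b^{22}_1}{2}u^1_{xx}+\tfrac{\partial_1r}{2}u^2_{xx}+\tfrac{\partial_3b^{22}_1}{2}u^1_xu^3_x+\tfrac{\partial_2b^{22}_1+\partial_1^2r}{2}u^1_xu^2_x+\tfrac{\partial_1\partial_3r}{2}u^2_xu^3_x\\&+\tfrac{\partial_1b^{22}_1}{2}(u^1_x)^2+\tfrac{\partial_1\partial_2r}{2}(u^2_x)^2,\end{aligned}$$ $$\gamma^{23}=\tfrac{\partial_1b^{21}_2-\partial_1\partial_2s}{2}u^2_xu^3_x-\left(\partial_1\partial_3s+\tfrac{\partial_1\partial_3r}{2}\right)(u^3_x)^2-(\partial_1s+\partial_1r)u^3_{xx},$$ $$\gamma^{31}=\tfrac{b^{21}_2-\partial_2s-\partial_2r}{2}u^3_{xx}+\left(\partial_1\partial_2s+\tfrac{\partial_1\partial_2r}{2}\right)u^1_xu^3_x+\tfrac{\partial_2b^{21}_2+\partial_2^2s+\partial_2^2r}{2}u^2_xu^3_x,$$ $$\gamma^{32}=\tfrac{\partial_1r}{2}u^3_{xx}-\left(\partial_1^2s+\tfrac{\partial_1^2r}{2}\right)u^1_xu^3_x-\tfrac{\partial_1b^{21}_2+\partial_1\partial_2s+\partial_1\partial_2r}{2}u^2_xu^3_x,$$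 for some functions $a,r,s,b^{11}_2,b^{21}_2,b^{22}_1$ of $(u^1,u^2,u^3)$. These six functions are arbitrary: for every choice of them, $P^{(3)}_0+\epsilon P_1$ is a first-order deformation of $P^{(3)}_0$. -/

import Mathlib

open TopologicalSpace
open scoped ContDiff

noncomputable section

namespace PoissonDeformation

/-! ### Smooth functions of `u = (u¹, …, uⁿ)` on an open set -/

/-- Extension by zero of a function on `U` to the whole coordinate space. -/
def extendZero {n : ℕ} {U : Opens (Fin n → ℝ)} (f : U → ℝ) : (Fin n → ℝ) → ℝ :=
  Function.extend (Subtype.val : U → (Fin n → ℝ)) f 0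

theorem extendZero_apply {n : ℕ} {U : Opens (Fin n → ℝ)} (f : U → ℝ) {x : Fin n → ℝ}
    (hx : x ∈ U) : extendZero f x = f ⟨x, hx⟩ :=
  Subtype.val_injective.extend_apply f 0 (⟨x, hx⟩ : U)

/-- The smooth functions on the open set `U`, as a subalgebra of all functions `U → ℝ`. -/
def smoothSubalgebra {n : ℕ} (U : Opens (Fin n → ℝ)) : Subalgebra ℝ (U → ℝ) where
  carrier := {f | ContDiffOn ℝ ∞ (extendZero f) (U : Set (Fin n → ℝ))}
  mul_mem' {f g} hf hg := by
    refine (ContDiffOn.mul hf hg).congr fun x hx => ?_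
    change _ = extendZero f x * extendZero g x
    rw [extendZero_apply _ hx, extendZero_apply _ hx, extendZero_apply _ hx]
    rfl
  add_mem' {f g} hf hg := by
    refine (ContDiffOn.add hf hg).congr fun x hx => ?_
    change _ = extendZero f x + extendZero g x
    rw [extendZero_apply _ hx, extendZero_apply _ hx, extendZero_apply _ hx]
    rfl
  algebraMap_mem' c := by
    refine (contDiffOn_const (c := c)).congr fun x hx => ?_
    rw [extendZero_apply _ hx]
    rfl

/-- The algebra `C^∞(U)` of real-valued smooth functions on the open set `U`. -/
def Smooth {n : ℕ} (U : Opens (Fin n → ℝ)) : Type := smoothSubalgebra U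

instance {n : ℕ} (U : Opens (Fin n → ℝ)) : CommRing (Smooth U) :=
  inferInstanceAs (CommRing (smoothSubalgebra U))

instance {n : ℕ} (U : Opens (Fin n → ℝ)) : Algebra ℝ (Smooth U) :=
  inferInstanceAs (Algebra ℝ (smoothSubalgebra U))

/-- The partial derivative `∂f/∂u^k` of a smooth function on `U`. -/
def pd {n : ℕ} {U : Opens (Fin n → ℝ)} (k : Fin n) (f : Smooth U) : Smooth U :=
  ⟨fun x => fderiv ℝ (extendZero f.1) x.1 (Pi.single k 1), by
    have h : ContDiffOn ℝ ∞ (fderiv ℝ (extendZero f.1)) (U : Set (Fin n → ℝ)) :=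
      ContDiffOn.fderiv_of_isOpen f.2 U.isOpen (by simp)
    refine (h.clm_apply (contDiffOn_const (c := Pi.single k 1))).congr fun x hx => ?_
    rw [extendZero_apply _ hx]⟩

/-! ### Differential polynomials -/

/-- Differential polynomials: polynomials in the jet variables `u^i_{(s)}`, `s ≥ 1`, with
coefficients smooth functions of `u`. The variable with index `(i, s)` is `u^i_{(s+1)}`, the
`(s+1)`-st `x`-derivative of `u^i`. -/
abbrev DiffPoly {n : ℕ} (U : Opens (Fin n → ℝ)) : Type :=
  MvPolynomial (Fin n × ℕ) (Smooth U)

/-- The grading: `deg f(u) = 0` and `deg u^i_{(s)} = s`. -/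
def IsHomog {n : ℕ} {U : Opens (Fin n → ℝ)} (f : DiffPoly U) (d : ℕ) : Prop :=
  MvPolynomial.IsWeightedHomogeneous (fun v : Fin n × ℕ => v.2 + 1) f d

/-- `∂/∂u^k` of a differential polynomial: differentiate the coefficients. -/
def coeffDeriv {n : ℕ} {U : Opens (Fin n → ℝ)} (k : Fin n) (f : DiffPoly U) : DiffPoly U :=
  ∑ m ∈ f.support, MvPolynomial.monomial m (pd k (f.coeff m))

/-- `∂f/∂u^k_{(s)}`, for every `s ≥ 0`, where `u^k_{(0)} = u^k`. -/
def jetDeriv {n : ℕ} {U : Opens (Fin n → ℝ)} (k : Fin n) : ℕ → DiffPoly U → DiffPoly U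
  | 0, f => coeffDeriv k f
  | s + 1, f => MvPolynomial.pderiv (k, s) f

/-- The order of the highest `x`-derivative on which `f` depends. -/
def jetOrder {n : ℕ} {U : Opens (Fin n → ℝ)} (f : DiffPoly U) : ℕ :=
  f.vars.sup fun v => v.2 + 1

/-- The total `x`-derivative `∑ u^k_{(s+1)} ∂/∂u^k_{(s)}`. -/
def totalDeriv {n : ℕ} {U : Opens (Fin n → ℝ)} (f : DiffPoly U) : DiffPoly U :=
  (∑ k, MvPolynomial.X (k, 0) * coeffDeriv k f) +
    MvPolynomial.mkDerivation (Smooth U)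
      (fun v : Fin n × ℕ => (MvPolynomial.X (v.1, v.2 + 1) : DiffPoly U)) f

/-! ### Local kernels at two points `x, y` and at three points `x, y, z` -/

/-- A local kernel `∑ m, f_m(u(x), u_x(x), …) δ^{(m)}(x - y)`, stored as the polynomial
`∑ m, f_m T^m`. It is the kernel of the differential operator `∑ m, f_m (d/dx)^m`. Only the
additive structure and the multiplication by the variable `T` and by differential polynomials
(evaluated at `x`) are used. -/
abbrev Kernel₂ {n : ℕ} (U : Opens (Fin n → ℝ)) : Type := Polynomial (DiffPoly U)

/-- A local kernel `∑ f_{ab}(u(x), u_x(x), …) δ^{(a)}(x - y) δ^{(b)}(x - z)`, stored as the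
polynomial `∑ f_{ab} T₀^a T₁^b`. -/
abbrev Kernel₃ {n : ℕ} (U : Opens (Fin n → ℝ)) : Type := MvPolynomial (Fin 2) (DiffPoly U)

/-- `∂_x` on two-point kernels:
`∂_x (f(x) δ^{(m)}(x-y)) = f_x(x) δ^{(m)}(x-y) + f(x) δ^{(m+1)}(x-y)`. -/
def dx₂ {n : ℕ} {U : Opens (Fin n → ℝ)} (F : Kernel₂ U) : Kernel₂ U :=
  (F.sum fun m f => Polynomial.monomial m (totalDeriv f)) + Polynomial.X * F

/-- `∂_x` on three-point kernels. -/
def dx₃ {n : ℕ} {U : Opens (Fin n → ℝ)} (F : Kernel₃ U) : Kernel₃ U :=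
  (∑ m ∈ F.support, MvPolynomial.monomial m (totalDeriv (F.coeff m))) +
    (MvPolynomial.X 0 + MvPolynomial.X 1) * F

/-- The normal form of `g(y) δ^{(m)}(x - y)`, namely
`∂_x^m (g(x) δ(x-y)) = ∑ k, (m choose k) (d^k g/dx^k)(x) δ^{(m-k)}(x-y)`. -/
def atY {n : ℕ} {U : Opens (Fin n → ℝ)} (g : DiffPoly U) (m : ℕ) : Kernel₂ U :=
  dx₂^[m] (Polynomial.C g)

/-- Exchange of `x` and `y` in `F(x, y) = ∑ f_m(x) δ^{(m)}(x-y)`: the normal form of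
`F(y, x) = ∑ f_m(y) δ^{(m)}(y-x) = ∑ (-1)^m f_m(y) δ^{(m)}(x-y)`. -/
def swapXY {n : ℕ} {U : Opens (Fin n → ℝ)} (F : Kernel₂ U) : Kernel₂ U :=
  F.sum fun m f => (-1) ^ m * atY f m

/-- For `F(x, y, z) = ∑ f_{ab}(x) δ^{(a)}(x-y) δ^{(b)}(x-z)`, the normal form at `x` of
`F(z, x, y) = ∑ f_{ab}(z) δ^{(a)}(z-x) δ^{(b)}(z-y)`, that is of
`∑ (-1)^a ∂_x^a (f_{ab}(x) δ^{(b)}(x-y) δ(x-z))`. -/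
def atZXY {n : ℕ} {U : Opens (Fin n → ℝ)} (F : Kernel₃ U) : Kernel₃ U :=
  ∑ m ∈ F.support,
    (-1) ^ m 0 * dx₃^[m 0] (MvPolynomial.C (F.coeff m) * MvPolynomial.X 0 ^ m 1)

/-- For `F(x, y, z) = ∑ f_{ab}(x) δ^{(a)}(x-y) δ^{(b)}(x-z)`, the normal form at `x` of
`F(y, z, x) = ∑ f_{ab}(y) δ^{(a)}(y-z) δ^{(b)}(y-x)`, that is of
`∑ (-1)^b ∂_x^b (f_{ab}(x) δ^{(a)}(x-z) δ(x-y))`. -/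
def atYZX {n : ℕ} {U : Opens (Fin n → ℝ)} (F : Kernel₃ U) : Kernel₃ U :=
  ∑ m ∈ F.support,
    (-1) ^ m 1 * dx₃^[m 1] (MvPolynomial.C (F.coeff m) * MvPolynomial.X 1 ^ m 0)

/-! ### Bivectors, Schouten bracket, Lie derivative -/

/-- Matrices `P^{ij}_{x,y}` of local kernels, equivalently matrix differential operators with
differential polynomial coefficients. -/
abbrev BivectorKernel {n : ℕ} (U : Opens (Fin n → ℝ)) : Type := Fin n → Fin n → Kernel₂ U

/-- `P` is homogeneous of degree `d`: `P = ∑_{s=0}^{d} A_s (d/dx)^{d-s}` with `deg A_s = s`. -/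
def HasDegree {n : ℕ} {U : Opens (Fin n → ℝ)} (P : BivectorKernel U) (d : ℕ) : Prop :=
  ∀ i j m, (m ≤ d → IsHomog ((P i j).coeff m) (d - m)) ∧ (d < m → (P i j).coeff m = 0)

/-- Skew-symmetry `P^{ij}_{x,y} = - P^{ji}_{y,x}`, i.e. `P^* = -P`. -/
def IsSkew {n : ℕ} {U : Opens (Fin n → ℝ)} (P : BivectorKernel U) : Prop :=
  ∀ i j, P i j = -swapXY (P j i)

/-- The term `∑_{l,s} (∂P^{ij}_{x,y}/∂u^l_{(s)}(x)) ∂_x^s Q^{lk}_{x,z}` of the Schouten bracket. -/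
def schoutenTerm {n : ℕ} {U : Opens (Fin n → ℝ)} (P Q : BivectorKernel U) (i j k : Fin n) :
    Kernel₃ U :=
  (P i j).sum fun a f =>
    ∑ l, ∑ s ∈ Finset.range (jetOrder f + 1),
      MvPolynomial.C (jetDeriv l s f) * MvPolynomial.X 0 ^ a *
        (dx₂^[s] (Q l k)).sum fun b g => MvPolynomial.C g * MvPolynomial.X 1 ^ b

/-- The Schouten bracket `[P, Q]^{ijk}_{x,y,z}`, in normal form at `x`. The kernels `P^{ij}_{x,y}`
depend on the fields at their first argument only, so that the terms of the bracket with
derivatives with respect to the fields at the second argument are zero. -/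
def schouten {n : ℕ} {U : Opens (Fin n → ℝ)} (P Q : BivectorKernel U) (i j k : Fin n) :
    Kernel₃ U :=
  (schoutenTerm P Q i j k + schoutenTerm Q P i j k) +
    atZXY (schoutenTerm P Q k i j + schoutenTerm Q P k i j) +
    atYZX (schoutenTerm P Q j k i + schoutenTerm Q P j k i)

/-- (Evolutionary) vector fields `∑_{i,s} ∂_x^s X^i ∂/∂u^i_{(s)}`, given by their components. -/
abbrev VField {n : ℕ} (U : Opens (Fin n → ℝ)) : Type := Fin n → DiffPoly U

/-- The vector field has degree `d`. -/
def VField.HasDegree {n : ℕ} {U : Opens (Fin n → ℝ)} (X : VField U) (d : ℕ) : Prop :=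
  ∀ i, IsHomog (X i) d

/-- The Lie derivative of `P` along `X`:
`∑_{k,s} ∂_x^s X^k(x) ∂P^{ij}/∂u^k_{(s)}(x) - (∂X^i(x)/∂u^k_{(s)}(x)) ∂_x^s P^{kj}_{x,y}
  - (∂X^j(y)/∂u^k_{(s)}(y)) ∂_y^s P^{ik}_{x,y}`, in normal form; note
`∂_y^s (f(x) δ^{(a)}(x-y)) = (-1)^s f(x) δ^{(a+s)}(x-y)`. -/
def lieDeriv {n : ℕ} {U : Opens (Fin n → ℝ)} (X : VField U) (P : BivectorKernel U) :
    BivectorKernel U := fun i j =>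
  ((P i j).sum fun a f =>
      Polynomial.monomial a
        (∑ k, ∑ s ∈ Finset.range (jetOrder f + 1), totalDeriv^[s] (X k) * jetDeriv k s f)) -
    (∑ k, ∑ s ∈ Finset.range (jetOrder (X i) + 1),
      Polynomial.C (jetDeriv k s (X i)) * dx₂^[s] (P k j)) -
    (∑ k, ∑ s ∈ Finset.range (jetOrder (X j) + 1),
      (P i k).sum fun a f => (-1) ^ s * Polynomial.C f * atY (jetDeriv k s (X j)) (a + s))

/-! ### Deformations and infinitesimal Miura transformations -/

/-- The formal series `P_ε = ∑ ε^m P_m` is a deformation of order `k` of `P₀`: its coefficient of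
order zero is `P₀`, every `P_m` is a skew-symmetric bivector of degree `m + 1`, and
`[P_ε, P_ε] = O(ε^{k+1})`. -/
def IsDeformation {n : ℕ} {U : Opens (Fin n → ℝ)} (k : ℕ) (P₀ : BivectorKernel U)
    (P : ℕ → BivectorKernel U) : Prop :=
  P 0 = P₀ ∧ (∀ m, HasDegree (P m) (m + 1) ∧ IsSkew (P m)) ∧
    ∀ m ≤ k, ∀ i j l, ∑ p ∈ Finset.HasAntidiagonal.antidiagonal m, schouten (P p.1) (P p.2) i j l = 0

/-- The action of the infinitesimal Miura transformation generated by `ε X`: the coefficient of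
`ε^m` in the Lie series `∑_q (1/q!) (Lie_{εX})^q P_ε`. -/
def miura {n : ℕ} {U : Opens (Fin n → ℝ)} (X : VField U) (P : ℕ → BivectorKernel U) (m : ℕ) :
    BivectorKernel U :=
  ∑ p ∈ Finset.HasAntidiagonal.antidiagonal m, (1 / (p.1.factorial : ℝ)) • (lieDeriv X)^[p.1] (P p.2)

/-- The series `P₀ + ε P₁`. -/
def affineSeries {n : ℕ} {U : Opens (Fin n → ℝ)} (P₀ P₁ : BivectorKernel U) :
    ℕ → BivectorKernel U
  | 0 => P₀
  | 1 => P₁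
  | _ => 0

/-! ### The three-component structure of rank zero and the normal form -/

/-- An open box: a product of open (bounded or unbounded) intervals. -/
def IsOpenBox (U : Opens (Fin 3 → ℝ)) : Prop :=
  ∃ I : Fin 3 → Set ℝ, (∀ k, IsOpen (I k) ∧ (I k).OrdConnected) ∧
    (U : Set (Fin 3 → ℝ)) = Set.univ.pi I

/-- The Poisson structure with `P^{12} = u³_x`, `P^{21} = -u³_x`, and all other entries zero. -/
def rankZero (U : Opens (Fin 3 → ℝ)) : BivectorKernel U :=
  let w : DiffPoly U := MvPolynomial.X (2, 0)
  ![![0, Polynomial.C w, 0],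
    ![-Polynomial.C w, 0, 0],
    ![0, 0, 0]]

/-- The operator `α d²/dx² + β d/dx + γ`. -/
def secondOrder {U : Opens (Fin 3 → ℝ)} (α β γ : Fin 3 → Fin 3 → DiffPoly U) :
    BivectorKernel U := fun i j =>
  Polynomial.C (α i j) * Polynomial.X ^ 2 + Polynomial.C (β i j) * Polynomial.X +
    Polynomial.C (γ i j)

/-- The normal form of first-order deformations. The functions `b11, b21, b22` are
`b^{11}_2, b^{21}_2, b^{22}_1`. -/
def normalForm {U : Opens (Fin 3 → ℝ)} (a r s b11 b21 b22 : Smooth U) : BivectorKernel U :=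
  let c : Smooth U → DiffPoly U := fun f => MvPolynomial.C f
  let h : ℝ := 1 / 2
  let q : ℝ := 1 / 4
  let d1 : Smooth U → Smooth U := pd 0
  let d2 : Smooth U → Smooth U := pd 1
  let d3 : Smooth U → Smooth U := pd 2
  let x1 : DiffPoly U := MvPolynomial.X (0, 0)
  let x2 : DiffPoly U := MvPolynomial.X (1, 0)
  let x3 : DiffPoly U := MvPolynomial.X (2, 0)
  let y1 : DiffPoly U := MvPolynomial.X (0, 1)
  let y2 : DiffPoly U := MvPolynomial.X (1, 1)
  let y3 : DiffPoly U := MvPolynomial.X (2, 1)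
  let α21 := c a
  let β11 := c (2 * d2 a - b21 - d2 s - d2 r) * x1 + c b11 * x2
  let β12 := c (d1 s - 2 * d1 a) * x1 + c (b21 - 2 * d2 a) * x2 - c (2 * d3 a) * x3
  let β13 := c (h • (b21 + d2 s + d2 r)) * x3
  let β21 := c (d1 s) * x1 + c b21 * x2
  let β22 := c b22 * x1 + c (d1 r) * x2
  let β23 := -c (d1 s + h • d1 r) * x3
  let γ11 :=
    c (d2 a - h • (b21 + d2 s + d2 r)) * y1
    + c (d1 (d2 a) - h • (d1 b21 + d1 (d2 s) + d1 (d2 r))) * x1 ^ 2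
    + c (d2 (d3 a) - h • (d3 b21 + d2 (d3 s) + d2 (d3 r))) * x1 * x3
    + c (h • d3 b11) * x2 * x3
    + c (h • b11) * y2
    + c (d2 (d2 a) - h • (d2 b21 + d2 (d2 r) + d2 (d2 s) - d1 b11)) * x1 * x2
    + c (h • d2 b11) * x2 ^ 2
  let γ12 :=
    c (q • (d2 (d2 s) + d2 (d2 r) + 3 * d2 b21 - d1 b11) - h • d2 (d2 a)) * x2 ^ 2
    + c (d1 (d3 s) - 2 * d1 (d3 a)) * x1 * x3
    + c (h • (3 * d1 b21 + 3 * d1 (d2 s)) + d1 (d2 r) - 2 * d1 (d2 a)) * x1 * x2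
    + c (d3 b21 - d2 (d3 a)) * x2 * x3
    + c (h • (3 * d1 (d1 s)) + q • (d2 b22 + d1 (d1 r)) - d1 (d1 a)) * x1 ^ 2
    + c (b21 - d2 a) * y2
    - c (d3 a) * y3
    + c (d1 s - d1 a) * y1
    - c (d3 (d3 a)) * x3 ^ 2
  let γ13 :=
    c (d2 s + d2 r) * y3
    + c (h • (d1 b21 - d1 (d2 s))) * x1 * x3
    + c (h • (d3 b21 + d2 (d3 s) + d2 (d3 r))) * x3 ^ 2
  let γ21 :=
    c (q • (d2 b21 + d1 b11 - d2 (d2 s) - d2 (d2 r)) - h • d2 (d2 a)) * x2 ^ 2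
    - c (q • (d2 b22 + d1 (d1 r)) + h • d1 (d1 s)) * x1 ^ 2
    - c (h • (d1 b21 + d1 (d2 s)) + d1 (d2 r)) * x1 * x2
    - c (d2 (d3 a)) * x2 * x3
  let γ22 :=
    c (h • b22) * y1
    + c (h • d1 r) * y2
    + c (h • d3 b22) * x1 * x3
    + c (h • (d2 b22 + d1 (d1 r))) * x1 * x2
    + c (h • d1 (d3 r)) * x2 * x3
    + c (h • d1 b22) * x1 ^ 2
    + c (h • d1 (d2 r)) * x2 ^ 2
  let γ23 :=
    c (h • (d1 b21 - d1 (d2 s))) * x2 * x3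
    - c (d1 (d3 s) + h • d1 (d3 r)) * x3 ^ 2
    - c (d1 s + d1 r) * y3
  let γ31 :=
    c (h • (b21 - d2 s - d2 r)) * y3
    + c (d1 (d2 s) + h • d1 (d2 r)) * x1 * x3
    + c (h • (d2 b21 + d2 (d2 s) + d2 (d2 r))) * x2 * x3
  let γ32 :=
    c (h • d1 r) * y3
    - c (d1 (d1 s) + h • d1 (d1 r)) * x1 * x3
    - c (h • (d1 b21 + d1 (d2 s) + d1 (d2 r))) * x2 * x3
  secondOrder
    ![![0, -α21, 0],
      ![α21, 0, 0],
      ![0, 0, 0]]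
    ![![β11, β12, β13],
      ![β21, β22, β23],
      ![β13, β23, 0]]
    ![![γ11, γ12, γ13],
      ![γ21, γ22, γ23],
      ![γ31, γ32, 0]]

end PoissonDeformation

end

/-!
Write `P₀ = u³_x J` with a constant skew-symmetric matrix `J`. Since `P₀` has order zero and
depends on the single jet variable `u³_x`, the bracket `[P₀, Q]` with `Q = α d²/dx² + β d/dx + γ`
is a short explicit expression: its coefficients at `δ^{(a)}(x-y) δ^{(b)}(x-z)` are given by
`bracketCoeff`, and `schouten_rankZero_secondOrder` identifies them. A skew-symmetric `Q` of
degree two is determined by finitely many functions of `u` (`exists_eq_skewBivector`), namely the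
coefficients `A`, `L`, `G`, `H` of the three entries below the diagonal and the coefficients `B`
of the diagonal, so that `[P₀, Q] = 0` becomes a linear system of partial differential equations
for these functions.

For a cocycle, only the components at `δ^{(a)}(x-y) δ(x-z)` of the system are needed. They kill
many of the coefficients and express others by derivatives (the lemmas `cocycle_*`). What remains
to be integrated are two equations of the form `∂₁f + ∂₂g = 0`. On a box each of them has a
potential (`IsOpenBox.exists_potential`), because every smooth function on a box has a smooth
antiderivative in each coordinate direction, obtained by integration along a segment. The first
potential is the function `s + r` of the normal form, where `r` is an antiderivative of a
coefficient of the entry `(2,2)`; the second one is the component `-ξ^3_3` of the vector field.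
The operator `Lie_ξ P₀` is computed in the same coordinates (`lieDeriv_rankZero_eq_skewBivector`),
and the other components of `ξ` are chosen to remove coefficients one by one; a last
antiderivative is needed for the coefficient of `(u³_x)²` in the entry `(2,1)`. Comparison of
coefficients then gives the normal form (`exists_add_lieDeriv_eq_normalForm`).

Conversely, all coefficients of `[P₀, P₁]` for a normal form `P₁` vanish identically in the six
functions and their derivatives (`normalBracketCoeff_zero_zero`, `normalBracketCoeff_eq_zero`), by
the commutation of partial derivatives alone. To keep these computations integral, the parameters
are taken to be `2a`, `4r`, `4s`, and four times the functions `b`.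
-/

noncomputable section

namespace PoissonDeformation

/-! ### Calculus in `C^∞(U)` -/

section Calculus

variable {n : ℕ} {U : Opens (Fin n → ℝ)}

theorem extendZero_contDiffAt (f : Smooth U) (x : U) : ContDiffAt ℝ ∞ (extendZero f.1) x.1 :=
  (f.2 : ContDiffOn ℝ ∞ (extendZero f.1) U).contDiffAt (U.isOpen.mem_nhds x.2)

theorem extendZero_differentiableAt (f : Smooth U) (x : U) :
    DifferentiableAt ℝ (extendZero f.1) x.1 :=
  (extendZero_contDiffAt f x).differentiableAt (by simp)

theorem smooth_ext {f g : Smooth U} (h : ∀ x : U, f.1 x = g.1 x) : f = g :=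
  Subtype.ext (funext h)

theorem extendZero_eventuallyEq {f : U → ℝ} {g : (Fin n → ℝ) → ℝ} (h : ∀ x : U, f x = g x.1)
    (x : U) : extendZero f =ᶠ[nhds x.1] g := by
  filter_upwards [U.isOpen.mem_nhds x.2] with y hy
  rw [extendZero_apply f hy, h ⟨y, hy⟩]

theorem pd_apply (k : Fin n) (f : Smooth U) (x : U) :
    (pd k f).1 x = fderiv ℝ (extendZero f.1) x.1 (Pi.single k 1) := rfl

/-- The partial derivative may be computed from any function that agrees with `f` on `U`. -/
theorem pd_apply_of_eq (k : Fin n) {f : Smooth U} {g : (Fin n → ℝ) → ℝ}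
    (h : ∀ x : U, f.1 x = g x.1) (x : U) :
    (pd k f).1 x = fderiv ℝ g x.1 (Pi.single k 1) := by
  rw [pd_apply, (extendZero_eventuallyEq h x).fderiv_eq]

theorem extendZero_coe (f : Smooth U) (x : U) : extendZero f.1 x.1 = f.1 x :=
  extendZero_apply f.1 x.2

theorem pd_add (k : Fin n) (f g : Smooth U) : pd k (f + g) = pd k f + pd k g := by
  refine smooth_ext fun x => ?_
  have h : ∀ y : U, (f + g).1 y = (extendZero f.1 + extendZero g.1) y.1 := fun y => by
    rw [Pi.add_apply, extendZero_coe, extendZero_coe]; rfl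
  rw [pd_apply_of_eq k h, fderiv_add (extendZero_differentiableAt f x)
    (extendZero_differentiableAt g x)]
  rfl

theorem pd_mul (k : Fin n) (f g : Smooth U) : pd k (f * g) = pd k f * g + f * pd k g := by
  refine smooth_ext fun x => ?_
  have h : ∀ y : U, (f * g).1 y = (extendZero f.1 * extendZero g.1) y.1 := fun y => by
    rw [Pi.mul_apply, extendZero_coe, extendZero_coe]; rfl
  rw [pd_apply_of_eq k h, fderiv_mul (extendZero_differentiableAt f x)
    (extendZero_differentiableAt g x), extendZero_coe, extendZero_coe]
  change f.1 x * (pd k g).1 x + g.1 x * (pd k f).1 x = (pd k f).1 x * g.1 x + f.1 x * (pd k g).1 x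
  ring

theorem pd_algebraMap (k : Fin n) (c : ℝ) : pd k (algebraMap ℝ (Smooth U) c) = 0 := by
  refine smooth_ext fun x => ?_
  rw [pd_apply_of_eq k (g := fun _ => c) (fun y => rfl), fderiv_fun_const]
  rfl

theorem pd_smul (k : Fin n) (c : ℝ) (f : Smooth U) : pd k (c • f) = c • pd k f := by
  rw [Algebra.smul_def, pd_mul, pd_algebraMap, zero_mul, zero_add, Algebra.smul_def]

/-- The partial derivative, as a derivation of `C^∞(U)`. -/
def pdDerivation (k : Fin n) : Derivation ℝ (Smooth U) (Smooth U) :=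
  Derivation.mk'
    { toFun := pd k
      map_add' := pd_add k
      map_smul' := fun c f =>
        pd_smul k c f }
    (fun f g => by
      change pd k (f * g) = f • pd k g + g • pd k f
      rw [pd_mul, smul_eq_mul, smul_eq_mul]; ring)

theorem pd_eq_pdDerivation (k : Fin n) (f : Smooth U) : pd k f = pdDerivation k f := rfl

@[simp] theorem pd_zero (k : Fin n) : pd k (0 : Smooth U) = 0 := map_zero (pdDerivation k)

theorem pd_neg (k : Fin n) (f : Smooth U) : pd k (-f) = -pd k f := map_neg (pdDerivation k) f

theorem pd_sub (k : Fin n) (f g : Smooth U) : pd k (f - g) = pd k f - pd k g :=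
  map_sub (pdDerivation k) f g

theorem pd_ofNat_mul (k : Fin n) (m : ℕ) [m.AtLeastTwo] (f : Smooth U) :
    pd k (ofNat(m) * f) = ofNat(m) * pd k f := by
  have h : pd k (ofNat(m) : Smooth U) = 0 := (pdDerivation k).map_natCast m
  rw [pd_mul, h, zero_mul, zero_add]

/-- Second partial derivatives commute. -/
theorem pd_comm (j k : Fin n) (f : Smooth U) : pd j (pd k f) = pd k (pd j f) := by
  refine smooth_ext fun x => ?_
  have h : ∀ l m : Fin n, (pd l (pd m f)).1 x
      = fderiv ℝ (fderiv ℝ (extendZero f.1)) x.1 (Pi.single l 1) (Pi.single m 1) := fun l m => by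
    have h2 : DifferentiableAt ℝ (fderiv ℝ (extendZero f.1)) x.1 :=
      ((extendZero_contDiffAt f x).fderiv_right (m := 1)
        (WithTop.coe_le_coe.2 le_top)).differentiableAt (by simp)
    rw [pd_apply_of_eq l (g := fun z => fderiv ℝ (extendZero f.1) z (Pi.single m 1))
      (fun y => rfl), fderiv_clm_apply h2 (differentiableAt_const _)]
    simp
  rw [h, h]
  exact ((extendZero_contDiffAt f x).isSymmSndFDerivAt (by
    simpa using (WithTop.coe_le_coe.2 le_top : ((2 : ℕ∞) : WithTop ℕ∞) ≤ ∞))) _ _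

end Calculus

/-! ### Antiderivatives on a box -/

section ParametricIntegral

variable {E : Type} [NormedAddCommGroup E] [NormedSpace ℝ E] [ProperSpace E]

open Set MeasureTheory intervalIntegral in
/-- Differentiation under the integral sign over a compact interval. -/
theorem hasFDerivAt_integral_of_contDiffOn {F : Type} [NormedAddCommGroup F] [NormedSpace ℝ F]
    {G : E × ℝ → F} {W : Set (E × ℝ)} (hW : IsOpen W) (hG : ContDiffOn ℝ 1 G W) {x₀ : E}
    (hx : ∀ t ∈ Icc (0 : ℝ) 1, (x₀, t) ∈ W) :
    HasFDerivAt (fun x => ∫ t in (0 : ℝ)..1, G (x, t))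
      (∫ t in (0 : ℝ)..1, (fderiv ℝ G (x₀, t)).comp (ContinuousLinearMap.inl ℝ E ℝ)) x₀ := by
  obtain ⟨u, v, hu, -, hxu, hv, huv⟩ := generalized_tube_lemma (isCompact_singleton (x := x₀))
    (isCompact_Icc (a := (0 : ℝ)) (b := 1)) hW (by
      rintro ⟨y, t⟩ ⟨hy, ht⟩
      obtain rfl : y = x₀ := hy
      exact hx t ht)
  obtain ⟨ε, hε, hball⟩ := Metric.nhds_basis_closedBall.mem_iff.1
    (hu.mem_nhds (hxu (mem_singleton x₀)))
  have hsub : Metric.closedBall x₀ ε ×ˢ Icc (0 : ℝ) 1 ⊆ W :=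
    (prod_mono hball hv).trans huv
  have hder : ContinuousOn (fderiv ℝ G) W := hG.continuousOn_fderiv_of_isOpen hW le_rfl
  have hder' : ContinuousOn
      (fun p => (fderiv ℝ G p).comp (ContinuousLinearMap.inl ℝ E ℝ)) W :=
    hder.clm_comp continuousOn_const
  obtain ⟨C, hC⟩ := ((isCompact_closedBall x₀ ε).prod isCompact_Icc).exists_bound_of_continuousOn
    (hder'.mono hsub)
  have hslice : ∀ {H : Type} [NormedAddCommGroup H] (g : E × ℝ → H), ContinuousOn g W →
      ∀ x ∈ Metric.closedBall x₀ ε, ContinuousOn (fun t => g (x, t)) (Icc 0 1) :=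
    fun g hg x hx => hg.comp (by fun_prop) fun t ht => hsub ⟨hx, ht⟩
  have hx₀ : x₀ ∈ Metric.closedBall x₀ ε := Metric.mem_closedBall_self hε.le
  have hI : uIoc (0 : ℝ) 1 ⊆ Icc (0 : ℝ) 1 := by
    rw [uIoc_of_le zero_le_one]; exact Ioc_subset_Icc_self
  refine hasFDerivAt_integral_of_dominated_of_fderiv_le (μ := volume) (F := fun x t => G (x, t))
    (F' := fun x t => (fderiv ℝ G (x, t)).comp (ContinuousLinearMap.inl ℝ E ℝ))
    (bound := fun _ => C) (Metric.closedBall_mem_nhds x₀ hε) ?_ ?_ ?_ ?_ ?_ ?_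
  · filter_upwards [Metric.closedBall_mem_nhds x₀ hε] with x hx
    exact ((hslice G hG.continuousOn x hx).mono hI).aestronglyMeasurable measurableSet_uIoc
  · refine ContinuousOn.intervalIntegrable ?_
    rw [uIcc_of_le zero_le_one]
    exact hslice G hG.continuousOn x₀ hx₀
  · exact ((hslice _ hder' x₀ hx₀).mono hI).aestronglyMeasurable measurableSet_uIoc
  · exact Filter.Eventually.of_forall fun t ht x hx => hC (x, t) ⟨hx, hI ht⟩
  · exact intervalIntegrable_const
  · refine Filter.Eventually.of_forall fun t ht x hx => ?_
    have hm : (x, t) ∈ W := hsub ⟨hx, hI ht⟩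
    have h1 : HasFDerivAt G (fderiv ℝ G (x, t)) (x, t) :=
      ((hG.contDiffAt (hW.mem_nhds hm)).differentiableAt one_ne_zero).hasFDerivAt
    exact h1.comp x (hasFDerivAt_prodMk_left x t)

open Set in
/-- An integral over a compact interval depends smoothly on parameters. -/
theorem contDiffOn_integral {W : Set (E × ℝ)} (hW : IsOpen W) {V : Set E} (hV : IsOpen V)
    (hVW : ∀ x ∈ V, ∀ t ∈ Icc (0 : ℝ) 1, (x, t) ∈ W) (m : ℕ) :
    ∀ {F : Type} [NormedAddCommGroup F] [NormedSpace ℝ F] {G : E × ℝ → F},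
      ContDiffOn ℝ ∞ G W → ContDiffOn ℝ m (fun x => ∫ t in (0 : ℝ)..1, G (x, t)) V := by
  induction m with
  | zero =>
    intro F _ _ G hG
    refine contDiffOn_zero.2 fun x hx => ?_
    exact (hasFDerivAt_integral_of_contDiffOn hW (hG.of_le (by simp))
      (hVW x hx)).continuousAt.continuousWithinAt
  | succ m ih =>
    intro F _ _ G hG
    have hd : ∀ x ∈ V, HasFDerivAt (fun x => ∫ t in (0 : ℝ)..1, G (x, t)) _ x := fun x hx =>
      hasFDerivAt_integral_of_contDiffOn hW (hG.of_le (by simp)) (hVW x hx)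
    refine (contDiffOn_succ_iff_fderiv_of_isOpen hV).2
      ⟨fun x hx => (hd x hx).differentiableAt.differentiableWithinAt,
        fun h => absurd h (WithTop.coe_ne_top (a := (m : ℕ∞))), ?_⟩
    have h1 : ContDiffOn ℝ ∞
        (fun p => (fderiv ℝ G p).comp (ContinuousLinearMap.inl ℝ E ℝ)) W :=
      (hG.fderiv_of_isOpen (m := ∞) hW (by simp)).clm_comp contDiffOn_const
    exact (ih h1).congr fun x hx => (hd x hx).fderiv

end ParametricIntegral


section Antiderivative

variable {n : ℕ} {U : Opens (Fin n → ℝ)}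

open Set in
/-- If `U` is stable under moving the `k`-th coordinate towards the value `c`, then every
`f ∈ C^∞(U)` has an antiderivative `F` in the direction `k`, namely
`F(u) = ∫_c^{u^k} f(u^1, …, t, …, u^n) dt`, and `F` does not depend on any further variable on which
`f` does not depend. -/
theorem exists_pd_eq_of_segment (k : Fin n) (c : ℝ)
    (hc : ∀ x ∈ U, ∀ t ∈ Icc (0 : ℝ) 1, Function.update x k (c + t * (x k - c)) ∈ U)
    (f : Smooth U) :
    ∃ F : Smooth U, pd k F = f ∧ ∀ j, j ≠ k → pd j f = 0 → pd j F = 0 := by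
  classical
  -- The point on the segment at time `t`, an affine function of `x` for fixed `t`.
  let σ : (Fin n → ℝ) × ℝ → (Fin n → ℝ) := fun p =>
    p.1 + Pi.single k ((1 - p.2) * (c - p.1 k))
  have hσ : ∀ x t, σ (x, t) = Function.update x k (c + t * (x k - c)) := fun x t => by
    ext i
    rcases eq_or_ne i k with rfl | hi
    · simp [σ]; ring
    · simp [σ, hi]
  have hσs : ContDiff ℝ ∞ σ := by
    refine contDiff_fst.add ?_
    have h1 : ContDiff ℝ ∞ fun p : (Fin n → ℝ) × ℝ => (1 - p.2) * (c - p.1 k) := by fun_prop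
    exact (ContinuousLinearMap.single ℝ (fun _ : Fin n => ℝ) k).contDiff.comp h1
  let W : Set ((Fin n → ℝ) × ℝ) := σ ⁻¹' (U : Set (Fin n → ℝ))
  have hW : IsOpen W := U.isOpen.preimage hσs.continuous
  let G : (Fin n → ℝ) × ℝ → ℝ := fun p => (p.1 k - c) * extendZero f.1 (σ p)
  have hf : ContDiffOn ℝ ∞ (extendZero f.1) U := f.2
  have hG : ContDiffOn ℝ ∞ G W := by
    refine ContDiffOn.mul ?_ (hf.comp hσs.contDiffOn fun p hp => hp)
    exact ContDiff.contDiffOn (by fun_prop)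
  have hUW : ∀ x ∈ (U : Set (Fin n → ℝ)), ∀ t ∈ Icc (0 : ℝ) 1, (x, t) ∈ W := fun x hx t ht => by
    change σ (x, t) ∈ U
    rw [hσ]; exact hc x hx t ht
  let I : (Fin n → ℝ) → ℝ := fun x => ∫ t in (0 : ℝ)..1, G (x, t)
  have hI : ContDiffOn ℝ ∞ I U :=
    contDiffOn_infty.2 fun m => contDiffOn_integral hW U.isOpen hUW m hG
  let F : Smooth U := ⟨fun x => I x.1, hI.congr fun x hx => extendZero_apply _ hx⟩
  have hσ1 : ∀ (j : Fin n) (x : Fin n → ℝ) (t s : ℝ), σ (x + s • Pi.single j 1, t)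
      = σ (x, t) + s • (if j = k then t • Pi.single k (1 : ℝ) else Pi.single j 1) := by
    intro j x t s
    ext i
    rcases eq_or_ne j k with rfl | hj
    · rcases eq_or_ne i j with rfl | hi
      · simp [σ]; ring
      · simp [σ, hi]
    · rcases eq_or_ne i k with rfl | hi
      · simp [σ, hj, hj.symm]
      · simp [σ, hi, hj]
  -- The partial derivatives of the integrand.
  have hder : ∀ (x : U) (t : ℝ), t ∈ Icc (0 : ℝ) 1 → ∀ j : Fin n,
      fderiv ℝ G (x.1, t) (Pi.single j 1, 0)
        = (if j = k then extendZero f.1 (σ (x.1, t)) else 0)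
          + (x.1 k - c) * fderiv ℝ (extendZero f.1) (σ (x.1, t))
              (if j = k then t • Pi.single k (1 : ℝ) else Pi.single j 1) := by
    intro x t ht j
    have hm := hUW x.1 x.2 t ht
    have hGd : DifferentiableAt ℝ G (x.1, t) :=
      (hG.contDiffAt (hW.mem_nhds hm)).differentiableAt (by simp)
    have hfd : DifferentiableAt ℝ (extendZero f.1) (σ (x.1, t)) :=
      (hf.contDiffAt (U.isOpen.mem_nhds hm)).differentiableAt (by simp)
    have hline : HasDerivAt (fun s : ℝ => (x.1, t) + s • ((Pi.single j 1 : Fin n → ℝ), (0 : ℝ)))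
        ((Pi.single j 1 : Fin n → ℝ), (0 : ℝ)) 0 := by
      simpa using ((hasDerivAt_id (0 : ℝ)).smul_const
        ((Pi.single j 1 : Fin n → ℝ), (0 : ℝ))).const_add (x.1, t)
    have h1 : HasDerivAt
        (fun s : ℝ => G ((x.1, t) + s • ((Pi.single j 1 : Fin n → ℝ), (0 : ℝ))))
        (fderiv ℝ G (x.1, t) (Pi.single j 1, 0)) 0 :=
      HasFDerivAt.comp_hasDerivAt (x := (0 : ℝ)) (l := G) (l' := fderiv ℝ G (x.1, t))
        (by simpa using hGd.hasFDerivAt) hline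
    set v : Fin n → ℝ := if j = k then t • Pi.single k (1 : ℝ) else Pi.single j 1 with hv
    have hline' : HasDerivAt (fun s : ℝ => σ (x.1, t) + s • v) v 0 := by
      simpa using ((hasDerivAt_id (0 : ℝ)).smul_const v).const_add (σ (x.1, t))
    have h2 : HasDerivAt (fun s : ℝ => extendZero f.1 (σ (x.1, t) + s • v))
        (fderiv ℝ (extendZero f.1) (σ (x.1, t)) v) 0 :=
      HasFDerivAt.comp_hasDerivAt (x := (0 : ℝ)) (l := extendZero f.1)
        (l' := fderiv ℝ (extendZero f.1) (σ (x.1, t))) (by simpa using hfd.hasFDerivAt) hline'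
    have h3 : HasDerivAt (fun s : ℝ => (x.1 k - c) + s * (if j = k then 1 else 0))
        (if j = k then 1 else 0) 0 := by
      simpa using ((hasDerivAt_id (0 : ℝ)).mul_const (if j = k then (1 : ℝ) else 0)).const_add
        (x.1 k - c)
    have h4 := h3.mul h2
    refine h1.unique (HasDerivAt.congr_deriv (h4.congr_of_eventuallyEq
      (Filter.Eventually.of_forall fun s => ?_)) ?_)
    · have : (x.1, t) + s • ((Pi.single j 1 : Fin n → ℝ), (0 : ℝ))
          = (x.1 + s • Pi.single j 1, t) := by simp
      simp only [G, this, hσ1, ← hv, Pi.mul_apply]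
      congr 1
      rcases eq_or_ne j k with rfl | hj
      · simp; ring
      · simp [hj, hj.symm]
    · simp
  have hpd : ∀ (j : Fin n) (x : U), (pd j F).1 x
      = ∫ t in (0 : ℝ)..1, fderiv ℝ G (x.1, t) (Pi.single j 1, 0) := by
    intro j x
    rw [pd_apply_of_eq j (g := I) (fun y => rfl),
      (hasFDerivAt_integral_of_contDiffOn hW (hG.of_le (by simp)) (hUW x.1 x.2)).fderiv,
      ContinuousLinearMap.intervalIntegral_apply]
    · rfl
    · refine ContinuousOn.intervalIntegrable ?_
      rw [uIcc_of_le zero_le_one]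
      have h1 : ContinuousOn
          (fun p => (fderiv ℝ G p).comp (ContinuousLinearMap.inl ℝ (Fin n → ℝ) ℝ)) W :=
        (hG.continuousOn_fderiv_of_isOpen hW (by simp)).clm_comp continuousOn_const
      exact h1.comp (by fun_prop) fun t ht => hUW x.1 x.2 t ht
  refine ⟨F, smooth_ext fun x => ?_, fun j hj hfj => smooth_ext fun x => ?_⟩
  · -- The integrand is the derivative of `t * f (σ (x, t))`.
    rw [hpd]
    have hprim : ∀ t ∈ uIcc (0 : ℝ) 1, HasDerivAt (fun t => t * extendZero f.1 (σ (x.1, t)))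
        (fderiv ℝ G (x.1, t) (Pi.single k 1, 0)) t := by
      intro t ht
      rw [uIcc_of_le zero_le_one] at ht
      have hfd : DifferentiableAt ℝ (extendZero f.1) (σ (x.1, t)) :=
        (hf.contDiffAt (U.isOpen.mem_nhds (hUW x.1 x.2 t ht))).differentiableAt (by simp)
      have hl : HasDerivAt (fun t => σ (x.1, t)) (Pi.single k (x.1 k - c)) t := by
        have h1 : HasDerivAt (fun t : ℝ => (1 - t) * (c - x.1 k)) (x.1 k - c) t := by
          simpa using ((hasDerivAt_id t).const_sub 1).mul_const (c - x.1 k)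
        exact ((ContinuousLinearMap.single ℝ (fun _ : Fin n => ℝ) k).hasFDerivAt.comp_hasDerivAt t
          h1).const_add x.1
      have h2 := (hasDerivAt_id t).mul (hfd.hasFDerivAt.comp_hasDerivAt t hl)
      refine h2.congr_deriv ?_
      have h3 : (Pi.single k (x.1 k - c) : Fin n → ℝ) = (x.1 k - c) • Pi.single k 1 := by
        rw [← Pi.single_smul, smul_eq_mul, mul_one]
      rw [hder x t ht k, if_pos rfl, if_pos rfl, h3, map_smul, map_smul]
      simp; ring
    rw [intervalIntegral.integral_eq_sub_of_hasDerivAt hprim]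
    · have : σ (x.1, 1) = x.1 := by rw [hσ]; simp
      rw [this, one_mul, zero_mul, sub_zero, extendZero_coe]
    · refine ContinuousOn.intervalIntegrable ?_
      rw [uIcc_of_le zero_le_one]
      have h1 : ContinuousOn (fun p => fderiv ℝ G p (Pi.single k 1, 0)) W :=
        (hG.continuousOn_fderiv_of_isOpen hW (by simp)).clm_apply continuousOn_const
      exact h1.comp (by fun_prop) fun t ht => hUW x.1 x.2 t ht
  · rw [hpd]
    refine intervalIntegral.integral_zero_ae (Filter.Eventually.of_forall fun t ht => ?_)
    have ht' : t ∈ Icc (0 : ℝ) 1 := by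
      rw [uIoc_of_le zero_le_one] at ht; exact Ioc_subset_Icc_self ht
    rw [hder x t ht' j, if_neg hj, if_neg hj]
    have h1 : (pd j f).1 ⟨σ (x.1, t), hUW x.1 x.2 t ht'⟩ = 0 := by rw [hfj]; rfl
    rw [pd_apply] at h1
    simp [h1]

end Antiderivative

/-- On an open box every smooth function has an antiderivative in each coordinate direction, which
may be taken independent of every further variable of which the function is independent. -/
theorem IsOpenBox.exists_pd_eq {U : Opens (Fin 3 → ℝ)} (hU : IsOpenBox U) (k : Fin 3)
    (f : Smooth U) : ∃ F : Smooth U, pd k F = f ∧ ∀ j, j ≠ k → pd j f = 0 → pd j F = 0 := by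
  obtain ⟨I, hI, hUI⟩ := hU
  have hmem : ∀ x : Fin 3 → ℝ, x ∈ U ↔ ∀ i, x i ∈ I i := fun x => by
    rw [← SetLike.mem_coe, hUI]; simp
  rcases Set.eq_empty_or_nonempty (U : Set (Fin 3 → ℝ)) with h | ⟨c, hc⟩
  · exact ⟨0, smooth_ext fun x => (Set.notMem_empty x.1 (h ▸ x.2)).elim, fun j _ _ => pd_zero j⟩
  · refine exists_pd_eq_of_segment k (c k) (fun x hx t ht => (hmem _).2 fun i => ?_) f
    have hx' := (hmem x).1 hx
    rcases eq_or_ne i k with rfl | hi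
    · rw [Function.update_self]
      have hconv : Convex ℝ (I i) := (hI i).2.convex
      have := hconv ((hmem c).1 hc i) (hx' i) (sub_nonneg.2 ht.2) ht.1 (by ring)
      simp only [smul_eq_mul] at this
      convert this using 1; ring
    · rw [Function.update_of_ne hi]; exact hx' i

/-- On an open box, a divergence-free pair of functions has a stream function. -/
theorem IsOpenBox.exists_potential {U : Opens (Fin 3 → ℝ)} (hU : IsOpenBox U) (f g : Smooth U)
    (h : pd 0 f + pd 1 g = 0) : ∃ F : Smooth U, pd 1 F = f ∧ pd 0 F = -g := by
  obtain ⟨F₁, hF₁, -⟩ := hU.exists_pd_eq 0 (-g)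
  -- The defect `f - ∂₂F₁` does not depend on `u¹`, and is integrated in the direction `u²`.
  have h0 : pd 0 (f - pd 1 F₁) = 0 := by
    rw [pd_sub, pd_comm, hF₁, pd_neg, sub_neg_eq_add, h]
  obtain ⟨F₂, hF₂, h₂⟩ := hU.exists_pd_eq 1 (f - pd 1 F₁)
  refine ⟨F₁ + F₂, ?_, ?_⟩
  · rw [pd_add, hF₂]; ring
  · rw [pd_add, hF₁, h₂ 0 (by decide) h0, add_zero]


/-! ### Derivations of the ring of differential polynomials -/

section DiffPolyCalculus

open MvPolynomial

variable {n : ℕ} {U : Opens (Fin n → ℝ)}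

theorem coeff_coeffDeriv (k : Fin n) (f : DiffPoly U) (m : Fin n × ℕ →₀ ℕ) :
    (coeffDeriv k f).coeff m = pd k (f.coeff m) := by
  classical
  simp only [coeffDeriv, coeff_sum, coeff_monomial, Finset.sum_ite_eq']
  split_ifs with h
  · rfl
  · rw [notMem_support_iff.1 h, pd_zero]

theorem coeffDeriv_add (k : Fin n) (f g : DiffPoly U) :
    coeffDeriv k (f + g) = coeffDeriv k f + coeffDeriv k g := by
  ext m
  simp only [coeff_coeffDeriv, coeff_add, pd_add]

theorem coeffDeriv_mul (k : Fin n) (f g : DiffPoly U) :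
    coeffDeriv k (f * g) = coeffDeriv k f * g + f * coeffDeriv k g := by
  classical
  ext m
  simp only [coeff_coeffDeriv, coeff_add, coeff_mul]
  rw [pd_eq_pdDerivation, map_sum, ← Finset.sum_add_distrib]
  exact Finset.sum_congr rfl fun p _ => pd_mul k _ _

theorem coeffDeriv_C (k : Fin n) (a : Smooth U) : coeffDeriv k (C a) = C (pd k a) := by
  classical
  ext m
  simp only [coeff_coeffDeriv, coeff_C]
  split_ifs <;> simp

theorem coeffDeriv_X (k : Fin n) (v : Fin n × ℕ) : coeffDeriv k (X v : DiffPoly U) = 0 := by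
  classical
  ext m
  simp only [coeff_coeffDeriv, coeff_X, coeff_zero]
  split_ifs
  · exact (pdDerivation k).map_one_eq_zero
  · exact pd_zero k

theorem totalDeriv_add (f g : DiffPoly U) : totalDeriv (f + g) = totalDeriv f + totalDeriv g := by
  simp only [totalDeriv, coeffDeriv_add, map_add, mul_add, Finset.sum_add_distrib]
  ring

theorem totalDeriv_mul (f g : DiffPoly U) :
    totalDeriv (f * g) = totalDeriv f * g + f * totalDeriv g := by
  simp only [totalDeriv, coeffDeriv_mul, Derivation.leibniz, mul_add, Finset.sum_add_distrib,
    add_mul, Finset.sum_mul, Finset.mul_sum, smul_eq_mul]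
  have h1 : ∑ k, X (k, 0) * (coeffDeriv k f * g) = ∑ k, X (k, 0) * coeffDeriv k f * g :=
    Finset.sum_congr rfl fun k _ => by ring
  have h2 : ∑ k, X (k, 0) * (f * coeffDeriv k g) = ∑ k, f * (X (k, 0) * coeffDeriv k g) :=
    Finset.sum_congr rfl fun k _ => by ring
  rw [h1, h2]
  ring

/-- The total derivative, as a derivation. -/
def totalDerivation : Derivation ℤ (DiffPoly U) (DiffPoly U) :=
  Derivation.mk' (AddMonoidHom.mk' totalDeriv totalDeriv_add).toIntLinearMap
    (fun f g => by
      change totalDeriv (f * g) = f • totalDeriv g + g • totalDeriv f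
      rw [totalDeriv_mul, smul_eq_mul, smul_eq_mul]; ring)

theorem totalDeriv_zero : totalDeriv (0 : DiffPoly U) = 0 := map_zero totalDerivation

theorem totalDeriv_neg (f : DiffPoly U) : totalDeriv (-f) = -totalDeriv f :=
  map_neg totalDerivation f

theorem totalDeriv_sub (f g : DiffPoly U) : totalDeriv (f - g) = totalDeriv f - totalDeriv g :=
  map_sub totalDerivation f g

theorem totalDeriv_ofNat (m : ℕ) [m.AtLeastTwo] : totalDeriv (ofNat(m) : DiffPoly U) = 0 :=
  totalDerivation.map_natCast m

theorem totalDeriv_ofNat_mul (m : ℕ) [m.AtLeastTwo] (f : DiffPoly U) :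
    totalDeriv (ofNat(m) * f) = ofNat(m) * totalDeriv f := by
  rw [totalDeriv_mul, totalDeriv_ofNat, zero_mul, zero_add]

theorem totalDeriv_C (a : Smooth U) : totalDeriv (C a) = ∑ k, X (k, 0) * C (pd k a) := by
  simp only [totalDeriv, coeffDeriv_C]
  rw [← algebraMap_eq, Derivation.map_algebraMap, add_zero]

theorem totalDeriv_X (k : Fin n) (s : ℕ) : totalDeriv (X (k, s) : DiffPoly U) = X (k, s + 1) := by
  simp only [totalDeriv, coeffDeriv_X, mul_zero, Finset.sum_const_zero, zero_add,
    mkDerivation_X]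

theorem jetDeriv_add (k : Fin n) (s : ℕ) (f g : DiffPoly U) :
    jetDeriv k s (f + g) = jetDeriv k s f + jetDeriv k s g := by
  cases s with
  | zero => exact coeffDeriv_add k f g
  | succ s => exact map_add (pderiv (k, s)) f g

theorem jetDeriv_mul (k : Fin n) (s : ℕ) (f g : DiffPoly U) :
    jetDeriv k s (f * g) = jetDeriv k s f * g + f * jetDeriv k s g := by
  cases s with
  | zero => exact coeffDeriv_mul k f g
  | succ s =>
    change pderiv (k, s) (f * g) = pderiv (k, s) f * g + f * pderiv (k, s) g
    rw [Derivation.leibniz, smul_eq_mul, smul_eq_mul]; ring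

/-- The partial derivative with respect to a jet variable, as a derivation. -/
def jetDerivation (k : Fin n) (s : ℕ) : Derivation ℤ (DiffPoly U) (DiffPoly U) :=
  Derivation.mk' (AddMonoidHom.mk' (jetDeriv k s) (jetDeriv_add k s)).toIntLinearMap
    (fun f g => by
      change jetDeriv k s (f * g) = f • jetDeriv k s g + g • jetDeriv k s f
      rw [jetDeriv_mul, smul_eq_mul, smul_eq_mul]; ring)

theorem jetDeriv_zero_right (k : Fin n) (s : ℕ) : jetDeriv k s (0 : DiffPoly U) = 0 :=
  map_zero (jetDerivation k s)

theorem jetDeriv_neg (k : Fin n) (s : ℕ) (f : DiffPoly U) :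
    jetDeriv k s (-f) = -jetDeriv k s f := map_neg (jetDerivation k s) f

theorem jetDeriv_sub (k : Fin n) (s : ℕ) (f g : DiffPoly U) :
    jetDeriv k s (f - g) = jetDeriv k s f - jetDeriv k s g := map_sub (jetDerivation k s) f g

theorem jetDeriv_ofNat_mul (k : Fin n) (s m : ℕ) [m.AtLeastTwo] (f : DiffPoly U) :
    jetDeriv k s (ofNat(m) * f) = ofNat(m) * jetDeriv k s f := by
  have h : jetDeriv k s (ofNat(m) : DiffPoly U) = 0 := (jetDerivation k s).map_natCast m
  rw [jetDeriv_mul, h, zero_mul, zero_add]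

theorem jetDeriv_zero_C (k : Fin n) (a : Smooth U) : jetDeriv k 0 (C a) = C (pd k a) :=
  coeffDeriv_C k a

theorem jetDeriv_succ_C (k : Fin n) (s : ℕ) (a : Smooth U) : jetDeriv k (s + 1) (C a) = 0 :=
  pderiv_C

theorem jetDeriv_zero_X (k : Fin n) (v : Fin n × ℕ) : jetDeriv k 0 (X v : DiffPoly U) = 0 :=
  coeffDeriv_X k v

theorem jetDeriv_succ_X (k l : Fin n) (s t : ℕ) :
    jetDeriv k (s + 1) (X (l, t) : DiffPoly U) = if l = k ∧ t = s then 1 else 0 := by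
  classical
  change pderiv (k, s) (X (l, t)) = _
  rw [pderiv_X, Pi.single_apply]
  simp only [Prod.mk.injEq]

theorem jetDeriv_eq_zero_of_jetOrder_lt {f : DiffPoly U} {s : ℕ} (k : Fin n)
    (h : jetOrder f < s) : jetDeriv k s f = 0 := by
  cases s with
  | zero => exact absurd h (Nat.not_lt_zero _)
  | succ s =>
    refine pderiv_eq_zero_of_notMem_vars fun hv => ?_
    exact absurd (Finset.le_sup (f := fun v : Fin n × ℕ => v.2 + 1) hv) (not_le.2 h)

theorem IsHomog.jetOrder_le {f : DiffPoly U} {d : ℕ} (h : IsHomog f d) : jetOrder f ≤ d := by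
  refine Finset.sup_le fun v hv => ?_
  obtain ⟨m, hm, hvm⟩ := (mem_vars_iff_mem_support v).1 hv
  rw [← h (mem_support_iff.1 hm)]
  exact Finsupp.le_weight_of_ne_zero' (fun v : Fin n × ℕ => v.2 + 1) (Finsupp.mem_support_iff.1 hvm)

theorem IsHomog.neg {f : DiffPoly U} {d : ℕ} (h : IsHomog f d) : IsHomog (-f) d :=
  fun m hm => h (d := m) (by rwa [coeff_neg, ne_eq, neg_eq_zero] at hm)

/-- Sums over the jet variables may be extended beyond the order of the differential polynomial. -/
theorem sum_range_jetOrder {M : Type*} [AddCommMonoid M] {f : DiffPoly U} {N : ℕ}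
    (h : jetOrder f ≤ N) (g : ℕ → M) (hg : ∀ s, jetOrder f < s → g s = 0) :
    ∑ s ∈ Finset.range (jetOrder f + 1), g s = ∑ s ∈ Finset.range (N + 1), g s := by
  refine Finset.sum_subset (Finset.range_mono (by omega)) fun s _ hs => hg s ?_
  simpa [Nat.lt_succ_iff] using hs

end DiffPolyCalculus

/-! ### Homogeneous differential polynomials of low degree -/

section Homogeneous

open MvPolynomial

variable {U : Opens (Fin 3 → ℝ)}

/-- The differential polynomial `∑ b_k u^k_x`. -/
def lin (b : Fin 3 → Smooth U) : DiffPoly U :=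
  C (b 0) * X (0, 0) + C (b 1) * X (1, 0) + C (b 2) * X (2, 0)

/-- The differential polynomial `∑ g_k u^k_{xx} + ∑_{k ≤ l} h_{kl} u^k_x u^l_x`. The entries of `h`
below the diagonal are not used. -/
def quad (g : Fin 3 → Smooth U) (h : Fin 3 → Fin 3 → Smooth U) : DiffPoly U :=
  C (g 0) * X (0, 1) + C (g 1) * X (1, 1) + C (g 2) * X (2, 1) +
    (C (h 0 0) * X (0, 0) ^ 2 + C (h 0 1) * (X (0, 0) * X (1, 0)) +
      C (h 0 2) * (X (0, 0) * X (2, 0)) + C (h 1 1) * X (1, 0) ^ 2 +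
      C (h 1 2) * (X (1, 0) * X (2, 0)) + C (h 2 2) * X (2, 0) ^ 2)

/-- A monomial of positive degree has a jet variable as a factor. -/
theorem exists_eq_add_single {d : ℕ} {m : Fin 3 × ℕ →₀ ℕ}
    (hm : Finsupp.weight (fun v : Fin 3 × ℕ => v.2 + 1) m = d + 1) :
    ∃ (m' : Fin 3 × ℕ →₀ ℕ) (v : Fin 3 × ℕ), m = m' + Finsupp.single v 1 ∧
      Finsupp.weight (fun v : Fin 3 × ℕ => v.2 + 1) m' + v.2 = d := by
  have h0 : m ≠ 0 := by rintro rfl; simp at hm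
  obtain ⟨v, hv⟩ := Finsupp.ne_iff.1 h0
  have hle : Finsupp.single v 1 ≤ m :=
    Finsupp.single_le_iff.2 (Nat.one_le_iff_ne_zero.2 hv)
  refine ⟨m - Finsupp.single v 1, v, (tsub_add_cancel_of_le hle).symm, ?_⟩
  rw [← tsub_add_cancel_of_le hle, map_add, Finsupp.weight_single] at hm
  simp only [one_smul] at hm
  omega

theorem eq_zero_of_weight_eq_zero {m : Fin 3 × ℕ →₀ ℕ}
    (hm : Finsupp.weight (fun v : Fin 3 × ℕ => v.2 + 1) m = 0) : m = 0 := by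
  by_contra h0
  obtain ⟨v, hv⟩ := Finsupp.ne_iff.1 h0
  have := Finsupp.le_weight_of_ne_zero' (fun v : Fin 3 × ℕ => v.2 + 1) hv
  omega

theorem IsHomog.induction {d : ℕ} {p : DiffPoly U → Prop} (h0 : p 0)
    (hadd : ∀ f g, p f → p g → p (f + g))
    (hmon : ∀ (m : Fin 3 × ℕ →₀ ℕ) (a : Smooth U),
      Finsupp.weight (fun v : Fin 3 × ℕ => v.2 + 1) m = d → p (monomial m a))
    {f : DiffPoly U} (hf : IsHomog f d) : p f := by
  rw [f.as_sum]
  exact Finset.sum_induction _ p hadd h0 fun m hm => hmon m _ (hf (mem_support_iff.1 hm))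

theorem IsHomog.exists_eq_C {f : DiffPoly U} (hf : IsHomog f 0) : ∃ a, f = C a := by
  refine IsHomog.induction (p := fun f => ∃ a, f = C a) ⟨0, by simp⟩ ?_ ?_ hf
  · rintro _ _ ⟨a, rfl⟩ ⟨b, rfl⟩
    exact ⟨a + b, by simp⟩
  · intro m a hm
    exact ⟨a, by rw [eq_zero_of_weight_eq_zero hm]; rfl⟩

theorem IsHomog.exists_eq_lin {f : DiffPoly U} (hf : IsHomog f 1) : ∃ b, f = lin b := by
  refine IsHomog.induction (p := fun f => ∃ b, f = lin b) ⟨0, by simp [lin]⟩ ?_ ?_ hf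
  · rintro _ _ ⟨b, rfl⟩ ⟨b', rfl⟩
    exact ⟨b + b', by simp only [lin, Pi.add_apply, map_add]; ring⟩
  · intro m a hm
    obtain ⟨m', ⟨k, s⟩, rfl, h⟩ := exists_eq_add_single hm
    obtain rfl : m' = 0 := eq_zero_of_weight_eq_zero (by omega)
    obtain rfl : s = 0 := by simpa using h
    refine ⟨Pi.single k a, ?_⟩
    rw [zero_add, ← C_mul_X_eq_monomial]
    fin_cases k <;> simp [lin]

theorem IsHomog.exists_eq_quad {f : DiffPoly U} (hf : IsHomog f 2) : ∃ g h, f = quad g h := by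
  refine IsHomog.induction (p := fun f => ∃ g h, f = quad g h) ⟨0, 0, by simp [quad]⟩ ?_ ?_ hf
  · rintro _ _ ⟨g, h, rfl⟩ ⟨g', h', rfl⟩
    exact ⟨g + g', h + h', by simp only [quad, Pi.add_apply, map_add]; ring⟩
  · intro m a hm
    obtain ⟨m', ⟨k, s⟩, rfl, h⟩ := exists_eq_add_single hm
    rcases Nat.lt_or_ge 0 s with hs | hs
    · obtain rfl : m' = 0 := eq_zero_of_weight_eq_zero (by simp only at h; omega)
      obtain rfl : s = 1 := by simpa using h
      refine ⟨Pi.single k a, 0, ?_⟩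
      rw [zero_add, ← C_mul_X_eq_monomial]
      fin_cases k <;> simp [quad]
    · obtain rfl : s = 0 := by omega
      obtain ⟨m'', ⟨l, t⟩, rfl, h'⟩ := exists_eq_add_single (d := 0) (m := m') (by simpa using h)
      obtain rfl : m'' = 0 := eq_zero_of_weight_eq_zero (by omega)
      obtain rfl : t = 0 := by simpa using h'
      have hmon : (monomial (0 + Finsupp.single (l, 0) 1 + Finsupp.single (k, 0) 1) a : DiffPoly U)
          = C a * (X (l, 0) * X (k, 0)) := by
        rw [zero_add, X, X, monomial_mul, C_mul_monomial]; simp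
      rw [hmon]
      refine ⟨0, Pi.single (min k l) (Pi.single (max k l) a), ?_⟩
      fin_cases k <;> fin_cases l <;> simp [quad] <;> ring

end Homogeneous


/-! ### Local kernels -/

section Kernels

theorem iterate_two_apply {A : Type*} (f : A → A) (x : A) : f^[2] x = f (f x) := rfl

theorem iterate_three_apply {A : Type*} (f : A → A) (x : A) : f^[3] x = f (f (f x)) := rfl

variable {n : ℕ} {U : Opens (Fin n → ℝ)}

theorem dx₂_add (F G : Kernel₂ U) : dx₂ (F + G) = dx₂ F + dx₂ G := by
  rw [dx₂, dx₂, dx₂, Polynomial.sum_add_index F G _ (by simp [totalDeriv_zero])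
    (by simp [totalDeriv_add])]
  ring

theorem dx₂_C_mul_X_pow (f : DiffPoly U) (m : ℕ) :
    dx₂ (Polynomial.C f * Polynomial.X ^ m)
      = Polynomial.C (totalDeriv f) * Polynomial.X ^ m
        + Polynomial.C f * Polynomial.X ^ (m + 1) := by
  rw [dx₂, Polynomial.C_mul_X_pow_eq_monomial, Polynomial.sum_monomial_index _ _
    (by simp [totalDeriv_zero]), ← Polynomial.C_mul_X_pow_eq_monomial,
    ← Polynomial.C_mul_X_pow_eq_monomial, pow_succ]
  ring

theorem dx₂_C (f : DiffPoly U) :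
    dx₂ (Polynomial.C f) = Polynomial.C (totalDeriv f) + Polynomial.C f * Polynomial.X := by
  simpa using dx₂_C_mul_X_pow f 0

theorem dx₂_C_mul_X (f : DiffPoly U) :
    dx₂ (Polynomial.C f * Polynomial.X)
      = Polynomial.C (totalDeriv f) * Polynomial.X + Polynomial.C f * Polynomial.X ^ 2 := by
  simpa using dx₂_C_mul_X_pow f 1

theorem dx₂_neg (F : Kernel₂ U) : dx₂ (-F) = -dx₂ F :=
  map_neg (AddMonoidHom.mk' dx₂ dx₂_add) F

theorem dx₂_zero : dx₂ (0 : Kernel₂ U) = 0 := map_zero (AddMonoidHom.mk' dx₂ dx₂_add)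

/-- An additive expression in the coefficients of a second-order operator. -/
theorem sum_secondOrder {M : Type*} [AddCommMonoid M] (φ : ℕ → DiffPoly U → M)
    (h0 : ∀ m, φ m 0 = 0) (hadd : ∀ m f g, φ m (f + g) = φ m f + φ m g) (a b c : DiffPoly U) :
    (Polynomial.C a * Polynomial.X ^ 2 + Polynomial.C b * Polynomial.X + Polynomial.C c).sum φ
      = φ 2 a + φ 1 b + φ 0 c := by
  rw [Polynomial.sum_add_index _ _ _ h0 hadd, Polynomial.sum_add_index _ _ _ h0 hadd,
    Polynomial.C_mul_X_pow_eq_monomial, Polynomial.C_mul_X_eq_monomial,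
    Polynomial.sum_monomial_index _ _ (h0 2), Polynomial.sum_monomial_index _ _ (h0 1),
    Polynomial.sum_C_index (h0 0)]

theorem sum_support_eq_of_subset {σ M : Type*} [AddCommMonoid M]
    (φ : (σ →₀ ℕ) → DiffPoly U → M) (h0 : ∀ m, φ m 0 = 0) {F : MvPolynomial σ (DiffPoly U)}
    {s : Finset (σ →₀ ℕ)} (hs : F.support ⊆ s) :
    ∑ m ∈ F.support, φ m (F.coeff m) = ∑ m ∈ s, φ m (F.coeff m) :=
  Finset.sum_subset hs fun m _ hm => by rw [MvPolynomial.notMem_support_iff.1 hm, h0]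

theorem sum_support_add {σ M : Type*} [AddCommMonoid M] (φ : (σ →₀ ℕ) → DiffPoly U → M)
    (h0 : ∀ m, φ m 0 = 0) (hadd : ∀ m f g, φ m (f + g) = φ m f + φ m g)
    (F G : MvPolynomial σ (DiffPoly U)) :
    ∑ m ∈ (F + G).support, φ m ((F + G).coeff m)
      = ∑ m ∈ F.support, φ m (F.coeff m) + ∑ m ∈ G.support, φ m (G.coeff m) := by
  classical
  rw [sum_support_eq_of_subset φ h0 (MvPolynomial.support_add (p := F) (q := G)),
    sum_support_eq_of_subset φ h0 (F := F) Finset.subset_union_left,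
    sum_support_eq_of_subset φ h0 (F := G) Finset.subset_union_right, ← Finset.sum_add_distrib]
  exact Finset.sum_congr rfl fun m _ => by rw [MvPolynomial.coeff_add, hadd]

theorem sum_support_monomial {σ M : Type*} [AddCommMonoid M] (φ : (σ →₀ ℕ) → DiffPoly U → M)
    (h0 : ∀ m, φ m 0 = 0) (m : σ →₀ ℕ) (f : DiffPoly U) :
    ∑ m' ∈ (MvPolynomial.monomial m f).support, φ m' ((MvPolynomial.monomial m f).coeff m')
      = φ m f := by
  classical
  rw [sum_support_eq_of_subset φ h0 MvPolynomial.support_monomial_subset, Finset.sum_singleton,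
    MvPolynomial.coeff_monomial, if_pos rfl]

theorem C_mul_X_pow_mul_X_pow (f : DiffPoly U) (a b : ℕ) :
    (MvPolynomial.C f * MvPolynomial.X 0 ^ a * MvPolynomial.X 1 ^ b : Kernel₃ U)
      = MvPolynomial.monomial (Finsupp.single 0 a + Finsupp.single 1 b) f := by
  rw [MvPolynomial.X_pow_eq_monomial, MvPolynomial.X_pow_eq_monomial, mul_assoc,
    MvPolynomial.monomial_mul, MvPolynomial.C_mul_monomial, mul_one, mul_one]

theorem dx₃_add (F G : Kernel₃ U) : dx₃ (F + G) = dx₃ F + dx₃ G := by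
  rw [dx₃, dx₃, dx₃, sum_support_add (fun m f => MvPolynomial.monomial m (totalDeriv f))
    (by simp [totalDeriv_zero]) (by simp [totalDeriv_add])]
  ring

theorem dx₃_C_mul_X_pow_mul_X_pow (f : DiffPoly U) (a b : ℕ) :
    dx₃ (MvPolynomial.C f * MvPolynomial.X 0 ^ a * MvPolynomial.X 1 ^ b)
      = MvPolynomial.C (totalDeriv f) * MvPolynomial.X 0 ^ a * MvPolynomial.X 1 ^ b
        + MvPolynomial.C f * MvPolynomial.X 0 ^ (a + 1) * MvPolynomial.X 1 ^ b
        + MvPolynomial.C f * MvPolynomial.X 0 ^ a * MvPolynomial.X 1 ^ (b + 1) := by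
  rw [dx₃, C_mul_X_pow_mul_X_pow f a b, sum_support_monomial
    (fun m f => MvPolynomial.monomial m (totalDeriv f)) (by simp [totalDeriv_zero]),
    ← C_mul_X_pow_mul_X_pow, ← C_mul_X_pow_mul_X_pow]
  ring

theorem dx₃_iterate_add (m : ℕ) (F G : Kernel₃ U) : dx₃^[m] (F + G) = dx₃^[m] F + dx₃^[m] G := by
  induction m generalizing F G with
  | zero => rfl
  | succ m ih => rw [Function.iterate_succ_apply, dx₃_add, ih]; rfl

theorem dx₃_iterate_zero (m : ℕ) : dx₃^[m] (0 : Kernel₃ U) = 0 :=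
  map_zero (AddMonoidHom.mk' (dx₃^[m]) (dx₃_iterate_add m))

theorem atZXY_add (F G : Kernel₃ U) : atZXY (F + G) = atZXY F + atZXY G :=
  sum_support_add (fun m f => (-1) ^ m 0 * dx₃^[m 0] (MvPolynomial.C f * MvPolynomial.X 0 ^ m 1))
    (by simp [dx₃_iterate_zero]) (by simp [add_mul, mul_add, dx₃_iterate_add]) F G

theorem atYZX_add (F G : Kernel₃ U) : atYZX (F + G) = atYZX F + atYZX G :=
  sum_support_add (fun m f => (-1) ^ m 1 * dx₃^[m 1] (MvPolynomial.C f * MvPolynomial.X 1 ^ m 0))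
    (by simp [dx₃_iterate_zero]) (by simp [add_mul, mul_add, dx₃_iterate_add]) F G

theorem atZXY_C_mul_X_pow_mul_X_pow (f : DiffPoly U) (a b : ℕ) :
    atZXY (MvPolynomial.C f * MvPolynomial.X 0 ^ a * MvPolynomial.X 1 ^ b)
      = (-1) ^ a * dx₃^[a] (MvPolynomial.C f * MvPolynomial.X 0 ^ b * MvPolynomial.X 1 ^ 0) := by
  rw [C_mul_X_pow_mul_X_pow f a b]
  refine (sum_support_monomial
    (fun m f => (-1) ^ m 0 * dx₃^[m 0] (MvPolynomial.C f * MvPolynomial.X 0 ^ m 1))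
    (by simp [dx₃_iterate_zero]) _ f).trans ?_
  simp

theorem atYZX_C_mul_X_pow_mul_X_pow (f : DiffPoly U) (a b : ℕ) :
    atYZX (MvPolynomial.C f * MvPolynomial.X 0 ^ a * MvPolynomial.X 1 ^ b)
      = (-1) ^ b * dx₃^[b] (MvPolynomial.C f * MvPolynomial.X 0 ^ 0 * MvPolynomial.X 1 ^ a) := by
  rw [C_mul_X_pow_mul_X_pow f a b]
  refine (sum_support_monomial
    (fun m f => (-1) ^ m 1 * dx₃^[m 1] (MvPolynomial.C f * MvPolynomial.X 1 ^ m 0))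
    (by simp [dx₃_iterate_zero]) _ f).trans ?_
  simp

end Kernels


/-! ### The Schouten bracket with the rank zero structure -/

section Bracket

variable {U : Opens (Fin 3 → ℝ)}

/-- The operator `∑_l J^{lk} ∂/∂u^l_{(s)}`, for the matrix `J` with `P₀ = u³_x J`: it is
`-∂/∂u²_{(s)}`, `∂/∂u¹_{(s)}` or `0`, for `k = 1, 2, 3`. -/
def hamDeriv (k : Fin 3) (s : ℕ) (f : DiffPoly U) : DiffPoly U :=
  ![-jetDeriv 1 s f, jetDeriv 0 s f, 0] k

/-- The constant skew-symmetric matrix `J` with `P₀ = u³_x J`. -/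
def orient (i j : Fin 3) : DiffPoly U := ![![0, 1, 0], ![-1, 0, 0], ![0, 0, 0]] i j

theorem rankZero_eq (i j : Fin 3) :
    rankZero U i j = Polynomial.C (orient i j * MvPolynomial.X (2, 0)) := by
  fin_cases i <;> fin_cases j <;> simp [rankZero, orient]

theorem isHomog_orient_mul (i j : Fin 3) :
    IsHomog (orient i j * MvPolynomial.X (2, 0) : DiffPoly U) 1 := by
  have hX : IsHomog (MvPolynomial.X (2, 0) : DiffPoly U) 1 :=
    MvPolynomial.isWeightedHomogeneous_X _ _ _
  fin_cases i <;> fin_cases j <;>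
    simp only [orient, Matrix.cons_val, Fin.zero_eta, Fin.mk_one, Fin.reduceFinMk, zero_mul,
      one_mul, neg_mul] <;>
    first
      | exact hX
      | exact MvPolynomial.isWeightedHomogeneous_zero _ _ _
      | exact hX.neg

theorem jetDeriv_orient_mul (i j l : Fin 3) (s : ℕ) :
    jetDeriv l s (orient i j * MvPolynomial.X (2, 0) : DiffPoly U)
      = if l = 2 ∧ s = 1 then orient i j else 0 := by
  rcases s with _ | s
  · fin_cases i <;> fin_cases j <;>
      simp [orient, jetDeriv_zero_X, jetDeriv_zero_right, jetDeriv_neg]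
  · rcases s with _ | s
    · fin_cases i <;> fin_cases j <;> fin_cases l <;>
        simp [orient, jetDeriv_succ_X, jetDeriv_zero_right, jetDeriv_neg]
    · fin_cases i <;> fin_cases j <;>
        simp [orient, jetDeriv_succ_X, jetDeriv_zero_right, jetDeriv_neg]

theorem secondOrder_apply (α β γ : Fin 3 → Fin 3 → DiffPoly U) (i j : Fin 3) :
    secondOrder α β γ i j = Polynomial.C (α i j) * Polynomial.X ^ 2
      + Polynomial.C (β i j) * Polynomial.X + Polynomial.C (γ i j) := rfl

theorem coeff_secondOrder (α β γ : Fin 3 → Fin 3 → DiffPoly U) (i j : Fin 3) (m : ℕ) :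
    (secondOrder α β γ i j).coeff m
      = if m = 0 then γ i j else if m = 1 then β i j else if m = 2 then α i j else 0 := by
  rcases m with _ | _ | _ | m <;> simp [secondOrder_apply, Polynomial.coeff_C, Polynomial.coeff_X]

theorem hasDegree_secondOrder {α β γ : Fin 3 → Fin 3 → DiffPoly U}
    (hα : ∀ i j, IsHomog (α i j) 0) (hβ : ∀ i j, IsHomog (β i j) 1)
    (hγ : ∀ i j, IsHomog (γ i j) 2) : HasDegree (secondOrder α β γ) 2 := by
  intro i j m
  rw [coeff_secondOrder]
  rcases m with _ | _ | _ | m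
  · simpa using hγ i j
  · simpa using hβ i j
  · simpa using hα i j
  · simp

theorem sum_C_mul_X_one_pow (F : Kernel₂ U) :
    (F.sum fun b g => (MvPolynomial.C g * MvPolynomial.X 1 ^ b : Kernel₃ U))
      = F.eval₂ MvPolynomial.C (MvPolynomial.X 1) :=
  Polynomial.eval₂_eq_sum.symm

/-- The only derivative of `P₀` is `∂P₀/∂u³_x = J`, so only the third row of `Q` enters. -/
theorem schoutenTerm_rankZero_left (α β γ : Fin 3 → Fin 3 → DiffPoly U) (i j k : Fin 3) :
    schoutenTerm (rankZero U) (secondOrder α β γ) i j k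
      = MvPolynomial.C (orient i j * totalDeriv (γ 2 k)) * MvPolynomial.X 0 ^ 0
            * MvPolynomial.X 1 ^ 0
        + MvPolynomial.C (orient i j * (γ 2 k + totalDeriv (β 2 k))) * MvPolynomial.X 0 ^ 0
            * MvPolynomial.X 1 ^ 1
        + MvPolynomial.C (orient i j * (β 2 k + totalDeriv (α 2 k))) * MvPolynomial.X 0 ^ 0
            * MvPolynomial.X 1 ^ 2
        + MvPolynomial.C (orient i j * α 2 k) * MvPolynomial.X 0 ^ 0
            * MvPolynomial.X 1 ^ 3 := by
  rw [schoutenTerm, rankZero_eq, Polynomial.sum_C_index]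
  · refine (Finset.sum_congr rfl fun l _ => sum_range_jetOrder
      (isHomog_orient_mul i j).jetOrder_le _ fun s hs => by
        rw [jetDeriv_eq_zero_of_jetOrder_lt _ hs, MvPolynomial.C_0, zero_mul, zero_mul]).trans ?_
    simp only [Fin.sum_univ_three, Finset.sum_range_succ, Finset.sum_range_zero,
      jetDeriv_orient_mul, sum_C_mul_X_one_pow, Function.iterate_zero, Function.iterate_one, id,
      secondOrder_apply, dx₂_add, dx₂_C_mul_X_pow, dx₂_C_mul_X, dx₂_C, Polynomial.eval₂_add,
      Polynomial.eval₂_mul, Polynomial.eval₂_C, Polynomial.eval₂_pow, Polynomial.eval₂_X]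
    simp
    ring
  · simp [jetDeriv_zero_right]

/-- The terms in which the coefficients of `Q` are differentiated; `Q` depends on jets of order at
most two. -/
theorem schoutenTerm_rankZero_right {α β γ : Fin 3 → Fin 3 → DiffPoly U}
    (hα : ∀ i j, IsHomog (α i j) 0) (hβ : ∀ i j, IsHomog (β i j) 1)
    (hγ : ∀ i j, IsHomog (γ i j) 2) (i j k : Fin 3) :
    schoutenTerm (secondOrder α β γ) (rankZero U) i j k
      = MvPolynomial.C (hamDeriv k 0 (α i j) * MvPolynomial.X (2, 0)) * MvPolynomial.X 0 ^ 2
            * MvPolynomial.X 1 ^ 0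
        + MvPolynomial.C (hamDeriv k 0 (β i j) * MvPolynomial.X (2, 0)
              + hamDeriv k 1 (β i j) * MvPolynomial.X (2, 1)) * MvPolynomial.X 0 ^ 1
            * MvPolynomial.X 1 ^ 0
        + MvPolynomial.C (hamDeriv k 0 (γ i j) * MvPolynomial.X (2, 0)
              + hamDeriv k 1 (γ i j) * MvPolynomial.X (2, 1)
              + hamDeriv k 2 (γ i j) * MvPolynomial.X (2, 2)) * MvPolynomial.X 0 ^ 0
            * MvPolynomial.X 1 ^ 0
        + MvPolynomial.C (hamDeriv k 1 (β i j) * MvPolynomial.X (2, 0)) * MvPolynomial.X 0 ^ 1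
            * MvPolynomial.X 1 ^ 1
        + MvPolynomial.C (hamDeriv k 1 (γ i j) * MvPolynomial.X (2, 0)
              + 2 * hamDeriv k 2 (γ i j) * MvPolynomial.X (2, 1)) * MvPolynomial.X 0 ^ 0
            * MvPolynomial.X 1 ^ 1
        + MvPolynomial.C (hamDeriv k 2 (γ i j) * MvPolynomial.X (2, 0)) * MvPolynomial.X 0 ^ 0
            * MvPolynomial.X 1 ^ 2 := by
  have hord : ∀ a, jetOrder ((secondOrder α β γ i j).coeff a) ≤ 2 := fun a => by
    by_cases ha : a ≤ 2
    · exact ((hasDegree_secondOrder hα hβ hγ i j a).1 ha).jetOrder_le.trans (by omega)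
    · rw [(hasDegree_secondOrder hα hβ hγ i j a).2 (by omega)]
      simp [jetOrder]
  have h1 : schoutenTerm (secondOrder α β γ) (rankZero U) i j k
      = (secondOrder α β γ i j).sum fun a f => ∑ l, ∑ s ∈ Finset.range 3,
        MvPolynomial.C (jetDeriv l s f) * MvPolynomial.X 0 ^ a *
          (dx₂^[s] (rankZero U l k)).sum fun b g => MvPolynomial.C g * MvPolynomial.X 1 ^ b := by
    refine Finset.sum_congr rfl fun a _ => Finset.sum_congr rfl fun l _ => ?_
    refine sum_range_jetOrder (hord a) _ fun s hs => ?_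
    rw [jetDeriv_eq_zero_of_jetOrder_lt _ hs, MvPolynomial.C_0, zero_mul, zero_mul]
  have hα1 : ∀ l s, jetDeriv l (s + 1) (α i j) = 0 := fun l s =>
    jetDeriv_eq_zero_of_jetOrder_lt _ ((hα i j).jetOrder_le.trans_lt (by omega))
  have hβ2 : ∀ l s, jetDeriv l (s + 2) (β i j) = 0 := fun l s =>
    jetDeriv_eq_zero_of_jetOrder_lt _ ((hβ i j).jetOrder_le.trans_lt (by omega))
  have hD : totalDeriv (MvPolynomial.X (2, 0) : DiffPoly U) = MvPolynomial.X (2, 1) :=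
    totalDeriv_X 2 0
  have hD' : totalDeriv (MvPolynomial.X (2, 1) : DiffPoly U) = MvPolynomial.X (2, 2) :=
    totalDeriv_X 2 1
  rw [h1, secondOrder_apply, sum_secondOrder _ (by simp [jetDeriv_zero_right])
    (fun m f g => by simp only [jetDeriv_add, map_add, add_mul, Finset.sum_add_distrib])]
  fin_cases k <;>
  · simp only [Fin.sum_univ_three, Finset.sum_range_succ, Finset.sum_range_zero,
      sum_C_mul_X_one_pow, Function.iterate_zero, Function.iterate_one,
      iterate_two_apply, id,
      rankZero, Matrix.cons_val, Fin.zero_eta, Fin.mk_one, Fin.reduceFinMk, dx₂_neg, dx₂_zero,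
      dx₂_add, dx₂_C_mul_X, dx₂_C, Polynomial.eval₂_add, Polynomial.eval₂_neg,
      Polynomial.eval₂_mul, Polynomial.eval₂_C, Polynomial.eval₂_pow, Polynomial.eval₂_X,
      Polynomial.eval₂_zero, hD, hD', hamDeriv, hα1 _ 0, hα1 _ 1, hβ2 _ 0, two_mul]
    simp
    try ring

/-- The coefficient of `δ^{(a)}(x-y) δ^{(b)}(x-z)` in the first of the three cyclic summands of
`[P₀, Q]^{ijk}`, for `Q = α d²/dx² + β d/dx + γ`. -/
def halfCoeff (α β γ : Fin 3 → Fin 3 → DiffPoly U) (i j k : Fin 3) : ℕ → ℕ → DiffPoly U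
  | 2, 0 => hamDeriv k 0 (α i j) * MvPolynomial.X (2, 0)
  | 1, 0 => hamDeriv k 0 (β i j) * MvPolynomial.X (2, 0)
      + hamDeriv k 1 (β i j) * MvPolynomial.X (2, 1)
  | 0, 0 => hamDeriv k 0 (γ i j) * MvPolynomial.X (2, 0)
      + hamDeriv k 1 (γ i j) * MvPolynomial.X (2, 1)
      + hamDeriv k 2 (γ i j) * MvPolynomial.X (2, 2) + orient i j * totalDeriv (γ 2 k)
  | 1, 1 => hamDeriv k 1 (β i j) * MvPolynomial.X (2, 0)
  | 0, 1 => hamDeriv k 1 (γ i j) * MvPolynomial.X (2, 0)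
      + 2 * hamDeriv k 2 (γ i j) * MvPolynomial.X (2, 1)
      + orient i j * (γ 2 k + totalDeriv (β 2 k))
  | 0, 2 => hamDeriv k 2 (γ i j) * MvPolynomial.X (2, 0)
      + orient i j * (β 2 k + totalDeriv (α 2 k))
  | 0, 3 => orient i j * α 2 k
  | _, _ => 0

/-- The coefficient of `δ^{(a)}(x-y) δ^{(b)}(x-z)` in `F(x, y, z) + F'(z, x, y) + F''(y, z, x)`, for
three kernels with coefficients `s`, `s'`, `s''` of the shape of `halfCoeff`. -/
def cyclicCoeff (s s' s'' : ℕ → ℕ → DiffPoly U) : ℕ → ℕ → DiffPoly U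
  | 3, 0 => s' 0 3 - s'' 0 3
  | 2, 1 => -(3 * s'' 0 3)
  | 1, 2 => -(3 * s'' 0 3)
  | 0, 3 => s 0 3 - s'' 0 3
  | 2, 0 => s 2 0 + s' 2 0 - s' 1 1 + s' 0 2 + s'' 0 2 - 3 * totalDeriv (s'' 0 3)
  | 1, 1 => s 1 1 + 2 * s' 2 0 - s' 1 1 - s'' 1 1 + 2 * s'' 0 2 - 6 * totalDeriv (s'' 0 3)
  | 0, 2 => s 0 2 + s' 2 0 + s'' 2 0 - s'' 1 1 + s'' 0 2 - 3 * totalDeriv (s'' 0 3)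
  | 1, 0 => s 1 0 + 2 * totalDeriv (s' 2 0) - s' 1 0 - totalDeriv (s' 1 1) + s' 0 1 - s'' 0 1
      + 2 * totalDeriv (s'' 0 2) - 3 * totalDeriv (totalDeriv (s'' 0 3))
  | 0, 1 => s 0 1 + 2 * totalDeriv (s' 2 0) - s' 1 0 + s'' 1 0 - totalDeriv (s'' 1 1) - s'' 0 1
      + 2 * totalDeriv (s'' 0 2) - 3 * totalDeriv (totalDeriv (s'' 0 3))
  | 0, 0 => s 0 0 + totalDeriv (totalDeriv (s' 2 0)) - totalDeriv (s' 1 0) + s' 0 0 + s'' 0 0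
      - totalDeriv (s'' 0 1) + totalDeriv (totalDeriv (s'' 0 2))
      - totalDeriv (totalDeriv (totalDeriv (s'' 0 3)))
  | _, _ => 0

/-- The coefficient of `δ^{(a)}(x-y) δ^{(b)}(x-z)` in `[P₀, Q]^{ijk}`. -/
def bracketCoeff (α β γ : Fin 3 → Fin 3 → DiffPoly U) (i j k : Fin 3) : ℕ → ℕ → DiffPoly U :=
  cyclicCoeff (halfCoeff α β γ i j k) (halfCoeff α β γ k i j) (halfCoeff α β γ j k i)

/-- The kernel with the given coefficients at the monomials that occur in `halfCoeff`. -/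
def lowKernel (s : ℕ → ℕ → DiffPoly U) : Kernel₃ U :=
  MvPolynomial.C (s 2 0) * MvPolynomial.X 0 ^ 2 * MvPolynomial.X 1 ^ 0
    + MvPolynomial.C (s 1 0) * MvPolynomial.X 0 ^ 1 * MvPolynomial.X 1 ^ 0
    + MvPolynomial.C (s 0 0) * MvPolynomial.X 0 ^ 0 * MvPolynomial.X 1 ^ 0
    + MvPolynomial.C (s 1 1) * MvPolynomial.X 0 ^ 1 * MvPolynomial.X 1 ^ 1
    + MvPolynomial.C (s 0 1) * MvPolynomial.X 0 ^ 0 * MvPolynomial.X 1 ^ 1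
    + MvPolynomial.C (s 0 2) * MvPolynomial.X 0 ^ 0 * MvPolynomial.X 1 ^ 2
    + MvPolynomial.C (s 0 3) * MvPolynomial.X 0 ^ 0 * MvPolynomial.X 1 ^ 3

theorem schoutenTerm_add_schoutenTerm {α β γ : Fin 3 → Fin 3 → DiffPoly U}
    (hα : ∀ i j, IsHomog (α i j) 0) (hβ : ∀ i j, IsHomog (β i j) 1)
    (hγ : ∀ i j, IsHomog (γ i j) 2) (i j k : Fin 3) :
    schoutenTerm (rankZero U) (secondOrder α β γ) i j k
        + schoutenTerm (secondOrder α β γ) (rankZero U) i j k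
      = lowKernel (halfCoeff α β γ i j k) := by
  rw [schoutenTerm_rankZero_left, schoutenTerm_rankZero_right hα hβ hγ]
  simp only [lowKernel, halfCoeff, map_add]
  ring

/-- The cyclic summands are brought to normal form at `x` by
`δ^{(a)}(z-x) δ^{(b)}(z-y) ↦ (-1)^a ∂_x^a (δ^{(b)}(x-y) δ(x-z))` and its analogue. -/
theorem lowKernel_add_atZXY_add_atYZX (s s' s'' : ℕ → ℕ → DiffPoly U) :
    lowKernel s + atZXY (lowKernel s') + atYZX (lowKernel s'')
      = MvPolynomial.C (cyclicCoeff s s' s'' 3 0) * MvPolynomial.X 0 ^ 3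
        + MvPolynomial.C (cyclicCoeff s s' s'' 2 0) * MvPolynomial.X 0 ^ 2
        + MvPolynomial.C (cyclicCoeff s s' s'' 1 0) * MvPolynomial.X 0
        + MvPolynomial.C (cyclicCoeff s s' s'' 0 0)
        + (MvPolynomial.C (cyclicCoeff s s' s'' 2 1) * MvPolynomial.X 0 ^ 2
          + MvPolynomial.C (cyclicCoeff s s' s'' 1 2) * MvPolynomial.X 0 * MvPolynomial.X 1
          + MvPolynomial.C (cyclicCoeff s s' s'' 0 3) * MvPolynomial.X 1 ^ 2
          + MvPolynomial.C (cyclicCoeff s s' s'' 1 1) * MvPolynomial.X 0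
          + MvPolynomial.C (cyclicCoeff s s' s'' 0 2) * MvPolynomial.X 1
          + MvPolynomial.C (cyclicCoeff s s' s'' 0 1)) * MvPolynomial.X 1 := by
  simp only [lowKernel, cyclicCoeff, atZXY_add, atYZX_add, atZXY_C_mul_X_pow_mul_X_pow,
    atYZX_C_mul_X_pow_mul_X_pow, Function.iterate_zero, Function.iterate_one, iterate_two_apply,
    iterate_three_apply, id, dx₃_add, dx₃_C_mul_X_pow_mul_X_pow, map_add, map_sub, map_mul, map_neg,
    map_ofNat]
  ring

theorem schouten_rankZero_secondOrder {α β γ : Fin 3 → Fin 3 → DiffPoly U}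
    (hα : ∀ i j, IsHomog (α i j) 0) (hβ : ∀ i j, IsHomog (β i j) 1)
    (hγ : ∀ i j, IsHomog (γ i j) 2) (i j k : Fin 3) :
    schouten (rankZero U) (secondOrder α β γ) i j k
      = MvPolynomial.C (bracketCoeff α β γ i j k 3 0) * MvPolynomial.X 0 ^ 3
        + MvPolynomial.C (bracketCoeff α β γ i j k 2 0) * MvPolynomial.X 0 ^ 2
        + MvPolynomial.C (bracketCoeff α β γ i j k 1 0) * MvPolynomial.X 0
        + MvPolynomial.C (bracketCoeff α β γ i j k 0 0)
        + (MvPolynomial.C (bracketCoeff α β γ i j k 2 1) * MvPolynomial.X 0 ^ 2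
          + MvPolynomial.C (bracketCoeff α β γ i j k 1 2) * MvPolynomial.X 0 * MvPolynomial.X 1
          + MvPolynomial.C (bracketCoeff α β γ i j k 0 3) * MvPolynomial.X 1 ^ 2
          + MvPolynomial.C (bracketCoeff α β γ i j k 1 1) * MvPolynomial.X 0
          + MvPolynomial.C (bracketCoeff α β γ i j k 0 2) * MvPolynomial.X 1
          + MvPolynomial.C (bracketCoeff α β γ i j k 0 1)) * MvPolynomial.X 1 := by
  rw [schouten, schoutenTerm_add_schoutenTerm hα hβ hγ, schoutenTerm_add_schoutenTerm hα hβ hγ,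
    schoutenTerm_add_schoutenTerm hα hβ hγ]
  exact lowKernel_add_atZXY_add_atYZX _ _ _

/-- The coefficients of `δ^{(a)}(x-y) δ(x-z)` vanish if the bracket does. They are read off by
setting the second variable of the kernel to zero, and they suffice to determine the cocycles. -/
theorem bracketCoeff_eq_zero {α β γ : Fin 3 → Fin 3 → DiffPoly U}
    (hα : ∀ i j, IsHomog (α i j) 0) (hβ : ∀ i j, IsHomog (β i j) 1)
    (hγ : ∀ i j, IsHomog (γ i j) 2) {i j k : Fin 3}
    (h : schouten (rankZero U) (secondOrder α β γ) i j k = 0) :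
    bracketCoeff α β γ i j k 3 0 = 0 ∧ bracketCoeff α β γ i j k 2 0 = 0 ∧
      bracketCoeff α β γ i j k 1 0 = 0 ∧ bracketCoeff α β γ i j k 0 0 = 0 := by
  rw [schouten_rankZero_secondOrder hα hβ hγ] at h
  have h' := congrArg (MvPolynomial.eval₂Hom Polynomial.C
    (![Polynomial.X, 0] : Fin 2 → Polynomial (DiffPoly U))) h
  simp only [map_add, map_mul, map_pow, MvPolynomial.coe_eval₂Hom, MvPolynomial.eval₂_C,
    MvPolynomial.eval₂_X, Matrix.cons_val_zero, Matrix.cons_val_one, mul_zero, add_zero,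
    map_zero] at h'
  refine ⟨?_, ?_, ?_, ?_⟩
  · simpa [Polynomial.coeff_X, Polynomial.coeff_C] using congrArg (fun p => p.coeff 3) h'
  · simpa [Polynomial.coeff_X, Polynomial.coeff_C] using congrArg (fun p => p.coeff 2) h'
  · simpa [Polynomial.coeff_X, Polynomial.coeff_C] using congrArg (fun p => p.coeff 1) h'
  · simpa [Polynomial.coeff_X, Polynomial.coeff_C] using congrArg (fun p => p.coeff 0) h'

theorem schouten_comm (P Q : BivectorKernel U) (i j k : Fin 3) :
    schouten P Q i j k = schouten Q P i j k := by
  simp only [schouten, add_comm (schoutenTerm P Q _ _ _)]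

end Bracket

/-! ### Skew-symmetry of second-order operators -/

section Transposition

variable {U : Opens (Fin 3 → ℝ)}

theorem swapXY_secondOrder (a b c : DiffPoly U) :
    swapXY (Polynomial.C a * Polynomial.X ^ 2 + Polynomial.C b * Polynomial.X + Polynomial.C c)
      = Polynomial.C a * Polynomial.X ^ 2 + Polynomial.C (2 * totalDeriv a - b) * Polynomial.X
        + Polynomial.C (totalDeriv (totalDeriv a) - totalDeriv b + c) := by
  have hadd : ∀ (m : ℕ) (f g : DiffPoly U), atY (f + g) m = atY f m + atY g m := fun m f g => by
    induction m with
    | zero => simp [atY]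
    | succ m ih =>
      simp only [atY, Function.iterate_succ_apply'] at ih ⊢
      rw [ih, dx₂_add]
  have h0 : ∀ m : ℕ, atY (0 : DiffPoly U) m = 0 := fun m => by
    simpa using hadd m 0 0
  rw [swapXY, sum_secondOrder _ (by simp [h0]) (by simp [hadd, mul_add])]
  simp only [atY, Function.iterate_zero, Function.iterate_one, iterate_two_apply, id, dx₂_C,
    dx₂_add, dx₂_C_mul_X, map_add, map_sub, map_mul, map_ofNat]
  ring

theorem secondOrder_injective {α β γ α' β' γ' : Fin 3 → Fin 3 → DiffPoly U} {i j k l : Fin 3}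
    (h : secondOrder α β γ i j = secondOrder α' β' γ' k l) :
    α i j = α' k l ∧ β i j = β' k l ∧ γ i j = γ' k l := by
  have hc := fun m => congrArg (fun p => p.coeff m) h
  simp only [coeff_secondOrder] at hc
  exact ⟨by simpa using hc 2, by simpa using hc 1, by simpa using hc 0⟩

/-- Skew-symmetry of a second-order operator in terms of its coefficients. -/
theorem isSkew_secondOrder_iff (α β γ : Fin 3 → Fin 3 → DiffPoly U) :
    IsSkew (secondOrder α β γ) ↔ ∀ i j, α i j = -α j i ∧ β i j = β j i - 2 * totalDeriv (α j i) ∧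
      γ i j = -γ j i + totalDeriv (β j i) - totalDeriv (totalDeriv (α j i)) := by
  have h : ∀ i j, -swapXY (secondOrder α β γ j i)
      = secondOrder (fun i j => -α j i) (fun i j => β j i - 2 * totalDeriv (α j i))
        (fun i j => -γ j i + totalDeriv (β j i) - totalDeriv (totalDeriv (α j i))) i j := by
    intro i j
    rw [secondOrder_apply, swapXY_secondOrder, secondOrder_apply]
    simp only [map_add, map_sub, map_mul, map_neg, map_ofNat]
    ring
  constructor
  · intro hs i j
    exact secondOrder_injective ((hs i j).trans (h i j))
  · intro hs i j
    rw [h i j, secondOrder_apply, secondOrder_apply, (hs i j).1, (hs i j).2.1, (hs i j).2.2]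

end Transposition

/-! ### Skew-symmetric bivectors of degree two -/

section SkewBivector

open MvPolynomial

variable {U : Opens (Fin 3 → ℝ)}

theorem C_smul_eq (c : ℝ) (f : Smooth U) : (C (c • f) : DiffPoly U) = c • C f := by
  classical
  ext m
  rw [coeff_smul, coeff_C, coeff_C]
  split_ifs <;> simp

/-- The coefficient of `d²/dx²` in `skewOp`. -/
def skewCoeffTwo (α : Fin 3 → DiffPoly U) : Fin 3 → Fin 3 → DiffPoly U :=
  ![![0, -α 0, -α 1], ![α 0, 0, -α 2], ![α 1, α 2, 0]]

/-- The coefficient of `d/dx` in `skewOp`. -/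
def skewCoeffOne (b α β : Fin 3 → DiffPoly U) : Fin 3 → Fin 3 → DiffPoly U :=
  let β' := fun e => β e - 2 * totalDeriv (α e)
  ![![2 * b 0, β' 0, β' 1], ![β 0, 2 * b 1, β' 2], ![β 1, β 2, 2 * b 2]]

/-- The coefficient of order zero in `skewOp`. -/
def skewCoeffZero (b α β γ : Fin 3 → DiffPoly U) : Fin 3 → Fin 3 → DiffPoly U :=
  let γ' := fun e => -γ e + totalDeriv (β e) - totalDeriv (totalDeriv (α e))
  ![![totalDeriv (b 0), γ' 0, γ' 1], ![γ 0, totalDeriv (b 1), γ' 2],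
    ![γ 1, γ 2, totalDeriv (b 2)]]

/-- The general skew-symmetric second-order operator: `2 b_i d/dx + (b_i)_x` in the diagonal entry
`(i, i)`, and `α_e d²/dx² + β_e d/dx + γ_e` in the entries `(2,1)`, `(3,1)`, `(3,2)` below the
diagonal, numbered by `e = 0, 1, 2`. -/
def skewOp (b α β γ : Fin 3 → DiffPoly U) : BivectorKernel U :=
  secondOrder (skewCoeffTwo α) (skewCoeffOne b α β) (skewCoeffZero b α β γ)

theorem isSkew_skewOp (b α β γ : Fin 3 → DiffPoly U) : IsSkew (skewOp b α β γ) := by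
  refine (isSkew_secondOrder_iff _ _ _).2 fun i j => ?_
  fin_cases i <;> fin_cases j <;>
    simp [skewCoeffTwo, skewCoeffOne, skewCoeffZero, totalDeriv_zero, totalDeriv_neg,
      totalDeriv_sub, totalDeriv_ofNat_mul] <;>
    ring

theorem skewOp_add (b α β γ b' α' β' γ' : Fin 3 → DiffPoly U) :
    skewOp b α β γ + skewOp b' α' β' γ' = skewOp (b + b') (α + α') (β + β') (γ + γ') := by
  have hadd : ∀ (α β γ α' β' γ' : Fin 3 → Fin 3 → DiffPoly U), secondOrder α β γ
      + secondOrder α' β' γ' = secondOrder (α + α') (β + β') (γ + γ') := by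
    intro α β γ α' β' γ'
    funext i j
    simp only [Pi.add_apply, secondOrder_apply, map_add]
    ring
  rw [skewOp, skewOp, skewOp, hadd]
  congr 1 <;> funext i j <;> fin_cases i <;> fin_cases j <;>
    simp [skewCoeffTwo, skewCoeffOne, skewCoeffZero, totalDeriv_add] <;> ring

/-- The skew-symmetric bivector of degree two with the given coefficients. -/
def skewBivector (A : Fin 3 → Smooth U) (B L G : Fin 3 → Fin 3 → Smooth U)
    (H : Fin 3 → Fin 3 → Fin 3 → Smooth U) : BivectorKernel U :=
  skewOp (fun i => lin (B i)) (fun e => C (A e)) (fun e => lin (L e)) (fun e => quad (G e) (H e))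

theorem lin_add (b b' : Fin 3 → Smooth U) : lin (b + b') = lin b + lin b' := by
  simp only [lin, Pi.add_apply, map_add]; ring

theorem quad_add (g g' : Fin 3 → Smooth U) (h h' : Fin 3 → Fin 3 → Smooth U) :
    quad (g + g') (h + h') = quad g h + quad g' h' := by
  simp only [quad, Pi.add_apply, map_add]; ring

theorem skewBivector_add (A A' : Fin 3 → Smooth U) (B L G B' L' G' : Fin 3 → Fin 3 → Smooth U)
    (H H' : Fin 3 → Fin 3 → Fin 3 → Smooth U) :
    skewBivector A B L G H + skewBivector A' B' L' G' H'
      = skewBivector (A + A') (B + B') (L + L') (G + G') (H + H') := by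
  rw [skewBivector, skewBivector, skewBivector, skewOp_add]
  congr 1 <;> funext e
  · exact (lin_add _ _).symm
  · exact (map_add C _ _).symm
  · exact (lin_add _ _).symm
  · exact (quad_add _ _ _ _).symm

theorem eq_of_two_mul_eq {f g : DiffPoly U} (h : 2 * f = g) : f = (1 / 2 : ℝ) • g := by
  rw [← h]; algebra

/-- Every skew-symmetric bivector of degree two is given by such coefficients. -/
theorem exists_eq_skewBivector {P : BivectorKernel U} (hd : HasDegree P 2) (hs : IsSkew P) :
    ∃ A B L G H, P = skewBivector A B L G H := by
  have hP : P = secondOrder (fun i j => (P i j).coeff 2) (fun i j => (P i j).coeff 1)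
      (fun i j => (P i j).coeff 0) := by
    funext i j
    refine Polynomial.ext fun m => ?_
    rw [coeff_secondOrder]
    rcases m with _ | _ | _ | m
    · simp
    · simp
    · simp
    · simpa using (hd i j (m + 3)).2 (by omega)
  choose A hA using fun i j => IsHomog.exists_eq_C ((hd i j 2).1 (by omega))
  choose L hL using fun i j => IsHomog.exists_eq_lin ((hd i j 1).1 (by omega))
  choose G H hQ using fun i j => IsHomog.exists_eq_quad ((hd i j 0).1 (by omega))
  rw [hP, isSkew_secondOrder_iff] at hs
  refine ⟨![A 1 0, A 2 0, A 2 1], fun i => (1 / 2 : ℝ) • L i i, ![L 1 0, L 2 0, L 2 1],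
    ![G 1 0, G 2 0, G 2 1], ![H 1 0, H 2 0, H 2 1], ?_⟩
  have hhalf : ∀ i, lin ((1 / 2 : ℝ) • L i i) = (1 / 2 : ℝ) • (P i i).coeff 1 := fun i => by
    rw [hL]
    simp only [lin, Pi.smul_apply, C_smul_eq]
    algebra
  have hα : ∀ i, (P i i).coeff 2 = 0 := fun i => by
    have h := eq_of_two_mul_eq (f := (P i i).coeff 2) (g := 0)
      (by linear_combination (hs i i).1)
    rwa [smul_zero] at h
  have hγ : ∀ i, (P i i).coeff 0 = totalDeriv ((1 / 2 : ℝ) • (P i i).coeff 1) := fun i => by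
    have h1 := (hs i i).2.2
    rw [hα, totalDeriv_zero, totalDeriv_zero, sub_zero] at h1
    have h2 : totalDeriv ((P i i).coeff 1) = 2 * totalDeriv ((1 / 2 : ℝ) • (P i i).coeff 1) := by
      rw [← totalDeriv_ofNat_mul]
      congr 1
      algebra
    rw [h2] at h1
    rw [eq_of_two_mul_eq (f := (P i i).coeff 0)
      (g := 2 * totalDeriv ((1 / 2 : ℝ) • (P i i).coeff 1)) (by linear_combination h1)]
    generalize totalDeriv ((1 / 2 : ℝ) • (P i i).coeff 1) = f
    algebra
  rw [hP, skewBivector, skewOp]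
  congr 1 <;> funext i j <;> fin_cases i <;> fin_cases j <;>
    simp only [skewCoeffTwo, skewCoeffOne, skewCoeffZero, Matrix.cons_val, Fin.zero_eta, Fin.mk_one,
      Fin.reduceFinMk, ← hA, ← hL, ← hQ, hhalf]
  · exact hα 0
  · exact (hs 0 1).1
  · exact (hs 0 2).1
  · exact hα 1
  · exact (hs 1 2).1
  · exact hα 2
  · algebra
  · exact (hs 0 1).2.1
  · exact (hs 0 2).2.1
  · algebra
  · exact (hs 1 2).2.1
  · algebra
  · exact hγ 0
  · exact (hs 0 1).2.2
  · exact (hs 0 2).2.2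
  · exact hγ 1
  · exact (hs 1 2).2.2
  · exact hγ 2

end SkewBivector


/-! ### Homogeneity and jet derivatives in low degree -/

section Degree

open MvPolynomial

variable {U : Opens (Fin 3 → ℝ)}

theorem totalDeriv_C_eq_lin (a : Smooth U) : totalDeriv (C a) = lin fun k => pd k a := by
  simp only [totalDeriv_C, Fin.sum_univ_three, lin]
  ring

theorem totalDeriv_lin (b : Fin 3 → Smooth U) :
    totalDeriv (lin b) = quad b ![![pd 0 (b 0), pd 1 (b 0) + pd 0 (b 1), pd 2 (b 0) + pd 0 (b 2)],
      ![0, pd 1 (b 1), pd 2 (b 1) + pd 1 (b 2)], ![0, 0, pd 2 (b 2)]] := by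
  simp only [lin, quad, totalDeriv_add, totalDeriv_mul, totalDeriv_C, totalDeriv_X,
    Fin.sum_univ_three, map_add, Matrix.cons_val]
  ring

theorem isHomog_C (a : Smooth U) : IsHomog (C a : DiffPoly U) 0 :=
  isWeightedHomogeneous_C _ _

theorem isHomog_X (v : Fin 3 × ℕ) : IsHomog (X v : DiffPoly U) (v.2 + 1) :=
  isWeightedHomogeneous_X _ _ _

theorem IsHomog.add {f g : DiffPoly U} {d : ℕ} (hf : IsHomog f d) (hg : IsHomog g d) :
    IsHomog (f + g) d :=
  IsWeightedHomogeneous.add hf hg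

theorem IsHomog.C_mul {f : DiffPoly U} {d : ℕ} (a : Smooth U) (hf : IsHomog f d) :
    IsHomog (C a * f) d := by
  have h := IsWeightedHomogeneous.mul (isHomog_C a) hf
  rwa [zero_add] at h

theorem isHomog_zero (d : ℕ) : IsHomog (0 : DiffPoly U) d :=
  isWeightedHomogeneous_zero _ _ _

theorem isHomog_lin (b : Fin 3 → Smooth U) : IsHomog (lin b) 1 :=
  (((isHomog_X (0, 0)).C_mul _).add ((isHomog_X (1, 0)).C_mul _)).add ((isHomog_X (2, 0)).C_mul _)

theorem isHomog_quad (g : Fin 3 → Smooth U) (h : Fin 3 → Fin 3 → Smooth U) :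
    IsHomog (quad g h) 2 := by
  have hX : ∀ k l, IsHomog (X (k, 0) * X (l, 0) : DiffPoly U) 2 := fun k l =>
    IsWeightedHomogeneous.mul (isHomog_X (k, 0)) (isHomog_X (l, 0))
  simp only [quad, pow_two]
  refine .add (.add (.add ?_ ?_) ?_) (.add (.add (.add (.add (.add ?_ ?_) ?_) ?_) ?_) ?_) <;>
    refine .C_mul _ ?_ <;> first | exact isHomog_X _ | exact hX _ _

theorem isHomog_skewCoeffTwo (A : Fin 3 → Smooth U) (i j : Fin 3) :
    IsHomog (skewCoeffTwo (fun e => C (A e)) i j) 0 := by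
  fin_cases i <;> fin_cases j <;>
    first | exact isHomog_zero _ | exact isHomog_C _ | exact (isHomog_C _).neg

theorem isHomog_skewCoeffOne (A : Fin 3 → Smooth U) (B L : Fin 3 → Fin 3 → Smooth U)
    (i j : Fin 3) :
    IsHomog (skewCoeffOne (fun i => lin (B i)) (fun e => C (A e)) (fun e => lin (L e)) i j) 1 := by
  have h2 : ∀ b : Fin 3 → Smooth U, IsHomog (2 * lin b) 1 := fun b => by
    rw [two_mul]
    exact (isHomog_lin b).add (isHomog_lin b)
  have h3 : ∀ e, IsHomog (lin (L e) - 2 * totalDeriv (C (A e))) 1 := fun e => by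
    rw [totalDeriv_C_eq_lin, sub_eq_add_neg]
    exact (isHomog_lin _).add (h2 _).neg
  fin_cases i <;> fin_cases j <;>
    simp only [skewCoeffOne, Matrix.cons_val, Fin.zero_eta, Fin.mk_one, Fin.reduceFinMk, h2, h3,
      isHomog_lin]

theorem isHomog_skewCoeffZero (A : Fin 3 → Smooth U) (B L G : Fin 3 → Fin 3 → Smooth U)
    (H : Fin 3 → Fin 3 → Fin 3 → Smooth U) (i j : Fin 3) :
    IsHomog (skewCoeffZero (fun i => lin (B i)) (fun e => C (A e)) (fun e => lin (L e))
      (fun e => quad (G e) (H e)) i j) 2 := by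
  have h2 : ∀ b : Fin 3 → Smooth U, IsHomog (totalDeriv (lin b)) 2 := fun b => by
    rw [totalDeriv_lin]
    exact isHomog_quad _ _
  have h3 : ∀ e, IsHomog (-quad (G e) (H e) + totalDeriv (lin (L e))
      - totalDeriv (totalDeriv (C (A e)))) 2 := fun e => by
    rw [totalDeriv_C_eq_lin, sub_eq_add_neg]
    exact ((isHomog_quad _ _).neg.add (h2 _)).add (h2 _).neg
  fin_cases i <;> fin_cases j <;>
    simp only [skewCoeffZero, Matrix.cons_val, Fin.zero_eta, Fin.mk_one, Fin.reduceFinMk, h2, h3,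
      isHomog_quad]

theorem hasDegree_skewBivector (A : Fin 3 → Smooth U) (B L G : Fin 3 → Fin 3 → Smooth U)
    (H : Fin 3 → Fin 3 → Fin 3 → Smooth U) : HasDegree (skewBivector A B L G H) 2 :=
  hasDegree_secondOrder (isHomog_skewCoeffTwo A) (isHomog_skewCoeffOne A B L)
    (isHomog_skewCoeffZero A B L G H)

theorem jetDeriv_zero_lin (k : Fin 3) (b : Fin 3 → Smooth U) :
    jetDeriv k 0 (lin b) = lin fun l => pd k (b l) := by
  simp only [lin, jetDeriv_add, jetDeriv_mul, jetDeriv_zero_C, jetDeriv_zero_X, mul_zero, add_zero]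

theorem jetDeriv_one_lin (k : Fin 3) (b : Fin 3 → Smooth U) : jetDeriv k 1 (lin b) = C (b k) := by
  rw [lin, ← zero_add 1]
  simp only [jetDeriv_add, jetDeriv_mul, jetDeriv_succ_C, jetDeriv_succ_X]
  fin_cases k <;> simp

theorem jetDeriv_zero_quad (k : Fin 3) (g : Fin 3 → Smooth U) (h : Fin 3 → Fin 3 → Smooth U) :
    jetDeriv k 0 (quad g h) = quad (fun l => pd k (g l)) (fun l m => pd k (h l m)) := by
  simp only [quad, jetDeriv_add, jetDeriv_mul, jetDeriv_zero_C, jetDeriv_zero_X, mul_zero,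
    add_zero, pow_two, zero_mul]

theorem jetDeriv_one_quad (k : Fin 3) (g : Fin 3 → Smooth U) (h : Fin 3 → Fin 3 → Smooth U) :
    jetDeriv k 1 (quad g h) = lin (![![2 * h 0 0, h 0 1, h 0 2], ![h 0 1, 2 * h 1 1, h 1 2],
      ![h 0 2, h 1 2, 2 * h 2 2]] k) := by
  have hC : ∀ a, jetDeriv k 1 (C a : DiffPoly U) = 0 := jetDeriv_succ_C k 0
  have hX : ∀ l t, jetDeriv k 1 (X (l, t) : DiffPoly U) = if l = k ∧ t = 0 then 1 else 0 :=
    fun l t => jetDeriv_succ_X k l 0 t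
  simp only [quad, jetDeriv_add, jetDeriv_mul, hC, hX, pow_two]
  fin_cases k <;> simp [lin, two_mul] <;> ring

theorem jetDeriv_two_quad (k : Fin 3) (g : Fin 3 → Smooth U) (h : Fin 3 → Fin 3 → Smooth U) :
    jetDeriv k 2 (quad g h) = C (g k) := by
  have hC : ∀ a, jetDeriv k 2 (C a : DiffPoly U) = 0 := jetDeriv_succ_C k 1
  have hX : ∀ l t, jetDeriv k 2 (X (l, t) : DiffPoly U) = if l = k ∧ t = 1 then 1 else 0 :=
    fun l t => jetDeriv_succ_X k l 1 t
  simp only [quad, jetDeriv_add, jetDeriv_mul, hC, hX, pow_two]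
  fin_cases k <;> simp

end Degree

/-! ### The Lie derivative of the rank zero structure -/

section Lie

open MvPolynomial

variable {U : Opens (Fin 3 → ℝ)}

/-- `Lie_ξ P₀` as a differential operator. It has order one: the terms of `Lie_ξ P₀` with second
derivatives of the delta function cannot occur, as `P₀` has order zero and `ξ` has order one. -/
theorem lieDeriv_rankZero (ξ : Fin 3 → Fin 3 → Smooth U) :
    lieDeriv (fun k => lin (ξ k)) (rankZero U)
      = secondOrder (fun _ _ => 0)
        (fun i j => -∑ k, (orient k j * C (ξ i k) - orient i k * C (ξ j k)) * X (2, 0))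
        (fun i j => orient i j * totalDeriv (lin (ξ 2))
          - ∑ k, orient k j * (jetDeriv k 0 (lin (ξ i)) * X (2, 0) + C (ξ i k) * X (2, 1))
          - ∑ k, orient i k * X (2, 0) * (jetDeriv k 0 (lin (ξ j)) - totalDeriv (C (ξ j k)))) := by
  funext i j
  have hord : ∀ b : Fin 3 → Smooth U, jetOrder (lin b) ≤ 1 := fun b => (isHomog_lin b).jetOrder_le
  have h1 : (∑ k, ∑ s ∈ Finset.range (jetOrder (lin (ξ i)) + 1),
      Polynomial.C (jetDeriv k s (lin (ξ i))) * dx₂^[s] (rankZero U k j))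
        = ∑ k, ∑ s ∈ Finset.range 2,
          Polynomial.C (jetDeriv k s (lin (ξ i))) * dx₂^[s] (rankZero U k j) :=
    Finset.sum_congr rfl fun k _ => sum_range_jetOrder (hord _) _ fun s hs => by
      rw [jetDeriv_eq_zero_of_jetOrder_lt _ hs, Polynomial.C_0, zero_mul]
  have hY : ∀ s k, ((rankZero U i k).sum fun a f =>
      (-1) ^ s * Polynomial.C f * atY (jetDeriv k s (lin (ξ j))) (a + s))
        = (-1) ^ s * Polynomial.C (orient i k * X (2, 0)) * atY (jetDeriv k s (lin (ξ j))) s :=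
    fun s k => by
      rw [rankZero_eq, Polynomial.sum_C_index (by simp), zero_add]
  have h2 : (∑ k, ∑ s ∈ Finset.range (jetOrder (lin (ξ j)) + 1),
      (-1) ^ s * Polynomial.C (orient i k * X (2, 0)) * atY (jetDeriv k s (lin (ξ j))) s)
        = ∑ k, ∑ s ∈ Finset.range 2,
          (-1) ^ s * Polynomial.C (orient i k * X (2, 0)) * atY (jetDeriv k s (lin (ξ j))) s :=
    Finset.sum_congr rfl fun k _ => sum_range_jetOrder (hord _) _ fun s hs => by
      have h0 : ∀ m, dx₂^[m] (0 : Kernel₂ U) = 0 := fun m => Function.iterate_fixed dx₂_zero m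
      rw [jetDeriv_eq_zero_of_jetOrder_lt _ hs, atY, Polynomial.C_0, h0, mul_zero]
  have h3 : ((rankZero U i j).sum fun a f => Polynomial.monomial a
      (∑ k, ∑ s ∈ Finset.range (jetOrder f + 1), totalDeriv^[s] (lin (ξ k)) * jetDeriv k s f))
        = Polynomial.C (orient i j * totalDeriv (lin (ξ 2))) := by
    rw [rankZero_eq, Polynomial.sum_C_index (by simp [jetDeriv_zero_right]),
      Polynomial.monomial_zero_left, Finset.sum_congr rfl fun l _ => sum_range_jetOrder
      (isHomog_orient_mul i j).jetOrder_le _ fun s hs => by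
        rw [jetDeriv_eq_zero_of_jetOrder_lt _ hs, mul_zero]]
    simp only [Fin.sum_univ_three, Finset.sum_range_succ, Finset.sum_range_zero,
      jetDeriv_orient_mul, Function.iterate_zero, Function.iterate_one, id]
    simp [mul_comm]
  have hD : ∀ k l, totalDeriv (orient k l * X (2, 0) : DiffPoly U) = orient k l * X (2, 1) := by
    intro k l
    have hc : totalDeriv (orient k l : DiffPoly U) = 0 := by
      fin_cases k <;> fin_cases l <;> simp [orient, totalDeriv_zero, totalDeriv_neg] <;>
        exact totalDerivation.map_one_eq_zero
    rw [totalDeriv_mul, hc, zero_mul, zero_add]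
    exact congrArg _ (totalDeriv_X 2 0)
  rw [lieDeriv, h3, h1]
  simp only [hY]
  rw [h2]
  simp only [Finset.sum_range_succ, Finset.sum_range_zero, Function.iterate_zero,
    Function.iterate_one, id, rankZero_eq, dx₂_C, hD, jetDeriv_one_lin, atY, Fin.sum_univ_three]
  simp only [secondOrder_apply, map_add, map_sub, map_mul, map_neg, map_zero, pow_zero, pow_one]
  ring

/-- `Lie_ξ P₀` in the coordinates of `skewBivector`. The components `ξ^1_3`, `ξ^2_3` enter only
through the coefficient of `(u³_x)²` in the entry `(2,1)`; the other entries of `ξ` move the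
coefficients that the reduction to normal form removes. -/
theorem lieDeriv_rankZero_eq_skewBivector (ξ : Fin 3 → Fin 3 → Smooth U) :
    lieDeriv (fun k => lin (ξ k)) (rankZero U) = skewBivector 0
      ![![0, 0, ξ 0 1], ![0, 0, -ξ 1 0], 0]
      ![![0, 0, ξ 1 1 - ξ 0 0], ![0, 0, ξ 2 1], ![0, 0, -ξ 2 0]]
      ![![-ξ 2 0, -ξ 2 1, ξ 1 1 - ξ 2 2], ![0, 0, ξ 2 1], ![0, 0, -ξ 2 0]]
      ![![![-pd 0 (ξ 2 0), -(pd 1 (ξ 2 0) + pd 0 (ξ 2 1)),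
            pd 1 (ξ 1 0) - pd 2 (ξ 2 0) - pd 0 (ξ 2 2)],
          ![0, -pd 1 (ξ 2 1),
            pd 0 (ξ 0 1) + pd 1 (ξ 1 1) - pd 1 (ξ 0 0) - pd 2 (ξ 2 1) - pd 1 (ξ 2 2)],
          ![0, 0, pd 0 (ξ 0 2) + pd 1 (ξ 1 2) - pd 2 (ξ 0 0) - pd 2 (ξ 2 2)]],
        ![![0, 0, pd 1 (ξ 2 0)], ![0, 0, pd 1 (ξ 2 1)], ![0, 0, pd 1 (ξ 2 2)]],
        ![![0, 0, -pd 0 (ξ 2 0)], ![0, 0, -pd 0 (ξ 2 1)], ![0, 0, -pd 0 (ξ 2 2)]]] := by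
  have hT : ∀ i j, (0 : DiffPoly U) = skewCoeffTwo (fun e => C ((0 : Fin 3 → Smooth U) e)) i j := by
    intro i j
    fin_cases i <;> fin_cases j <;> simp [skewCoeffTwo]
  rw [lieDeriv_rankZero, skewBivector, skewOp]
  congr 1 <;> funext i j
  · exact hT i j
  · fin_cases i <;> fin_cases j <;>
    · simp only [skewCoeffOne, orient, Fin.sum_univ_three, Matrix.cons_val, Fin.zero_eta,
        Fin.mk_one, Fin.reduceFinMk, Pi.zero_apply, totalDeriv_zero, lin, map_sub, map_neg,
        map_zero]
      ring
  · fin_cases i <;> fin_cases j <;>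
    · simp only [skewCoeffZero, orient, Fin.sum_univ_three, Matrix.cons_val, Fin.zero_eta,
        Fin.mk_one, Fin.reduceFinMk, Pi.zero_apply, C_0, totalDeriv_zero, jetDeriv_zero_lin,
        totalDeriv_lin, totalDeriv_C]
      simp only [lin, quad, Matrix.cons_val, Pi.zero_apply, map_add, map_sub, map_neg,
        map_zero, pd_zero, pd_neg, pd_sub]
      ring

end Lie

/-! ### The normal form -/

section NormalForm

open MvPolynomial

variable {U : Opens (Fin 3 → ℝ)}

/-- The coefficients of the bracket of `P₀` with a skew-symmetric bivector of degree two. -/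
def skewBracketCoeff (A : Fin 3 → Smooth U) (B L G : Fin 3 → Fin 3 → Smooth U)
    (H : Fin 3 → Fin 3 → Fin 3 → Smooth U) : Fin 3 → Fin 3 → Fin 3 → ℕ → ℕ → DiffPoly U :=
  let α := fun e => C (A e)
  let b := fun i => lin (B i)
  let β := fun e => lin (L e)
  let γ := fun e => quad (G e) (H e)
  bracketCoeff (skewCoeffTwo α) (skewCoeffOne b α β) (skewCoeffZero b α β γ)

/-- The coefficients of `d²/dx²` below the diagonal in the normal form with parameters
`2a, 4r, 4s, …`; these multiples make all coefficients integral. -/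
def normalA (a : Smooth U) : Fin 3 → Smooth U := ![2 * a, 0, 0]

/-- Half of the coefficients of `d/dx` on the diagonal in this normal form. -/
def normalB (a r s b11 b21 b22 : Smooth U) : Fin 3 → Fin 3 → Smooth U :=
  ![![2 * (pd 1 a - b21 - pd 1 s - pd 1 r), 2 * b11, 0], ![2 * b22, 2 * pd 0 r, 0], ![0, 0, 0]]

/-- The coefficients of `d/dx` below the diagonal in this normal form. -/
def normalL (r s b21 : Smooth U) : Fin 3 → Fin 3 → Smooth U :=
  ![![4 * pd 0 s, 4 * b21, 0], ![0, 0, 2 * (b21 + pd 1 s + pd 1 r)],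
    ![0, 0, -(4 * pd 0 s + 2 * pd 0 r)]]

/-- The coefficients of `u^k_{xx}` below the diagonal in this normal form. -/
def normalG (r s b21 : Smooth U) : Fin 3 → Fin 3 → Smooth U :=
  ![![0, 0, 0], ![0, 0, 2 * (b21 - pd 1 s - pd 1 r)], ![0, 0, 2 * pd 0 r]]

/-- The coefficients of `u^k_x u^l_x` below the diagonal in this normal form. -/
def normalH (a r s b11 b21 b22 : Smooth U) : Fin 3 → Fin 3 → Fin 3 → Smooth U :=
  ![![![-(pd 1 b22 + pd 0 (pd 0 r) + 2 * pd 0 (pd 0 s)),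
        -(2 * (pd 0 b21 + pd 0 (pd 1 s)) + 4 * pd 0 (pd 1 r)), 0],
      ![0, pd 1 b21 + pd 0 b11 - pd 1 (pd 1 s) - pd 1 (pd 1 r) - pd 1 (pd 1 a),
        -(2 * pd 1 (pd 2 a))],
      ![0, 0, 0]],
    ![![0, 0, 4 * pd 0 (pd 1 s) + 2 * pd 0 (pd 1 r)],
      ![0, 0, 2 * (pd 1 b21 + pd 1 (pd 1 s) + pd 1 (pd 1 r))], ![0, 0, 0]],
    ![![0, 0, -(4 * pd 0 (pd 0 s) + 2 * pd 0 (pd 0 r))],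
      ![0, 0, -(2 * (pd 0 b21 + pd 0 (pd 1 s) + pd 0 (pd 1 r)))], ![0, 0, 0]]]

set_option maxHeartbeats 1600000 in
/-- The normal form is skew-symmetric of degree two, with these coordinates. -/
theorem normalForm_eq_skewBivector (a r s b11 b21 b22 : Smooth U) :
    normalForm (2 * a) (4 * r) (4 * s) (4 * b11) (4 * b21) (4 * b22)
      = skewBivector (normalA a) (normalB a r s b11 b21 b22) (normalL r s b21) (normalG r s b21)
        (normalH a r s b11 b21 b22) := by
  rw [normalForm, skewBivector, skewOp]
  congr 1 <;> funext i j
  · fin_cases i <;> fin_cases j <;> simp [skewCoeffTwo, normalA]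
  · fin_cases i <;> fin_cases j <;>
    · simp only [skewCoeffOne, normalA, normalB, normalL, Matrix.cons_val, Fin.zero_eta,
        Fin.mk_one, Fin.reduceFinMk, totalDeriv_zero, totalDeriv_C, lin, Fin.sum_univ_three,
        map_add, map_mul, map_ofNat, map_sub, map_neg, map_zero, C_smul_eq, pd_ofNat_mul,
        totalDeriv_ofNat_mul]
      algebra
  · fin_cases i <;> fin_cases j <;>
    · simp only [skewCoeffZero, normalA, normalB, normalL, normalG, normalH, Matrix.cons_val,
        Fin.zero_eta, Fin.mk_one, Fin.reduceFinMk, C_0, totalDeriv_zero, totalDeriv_C_eq_lin,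
        totalDeriv_lin]
      simp only [quad, Matrix.cons_val, pd_add, pd_sub, pd_neg, pd_zero, pd_ofNat_mul, map_add,
        map_mul, map_ofNat, map_sub, map_neg, map_zero, C_smul_eq, pd_comm 1 0, pd_comm 2 0,
        pd_comm 2 1]
      algebra

end NormalForm

/-! ### The normal form is a cocycle -/

section Cocycle

open MvPolynomial

variable {U : Opens (Fin 3 → ℝ)}

set_option maxHeartbeats 40000000 in
/-- The part of `[P₀, Q]` without derivatives of delta functions vanishes for the normal form. -/
theorem normalBracketCoeff_zero_zero (a r s b11 b21 b22 : Smooth U) (i j k : Fin 3) :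
    skewBracketCoeff (normalA a) (normalB a r s b11 b21 b22) (normalL r s b21) (normalG r s b21)
      (normalH a r s b11 b21 b22) i j k 0 0 = 0 := by
  fin_cases i <;> fin_cases j <;> fin_cases k <;>
  · simp only [skewBracketCoeff, bracketCoeff, cyclicCoeff, halfCoeff, skewCoeffTwo, skewCoeffOne,
      skewCoeffZero, orient, hamDeriv, normalA, normalB, normalL, normalG, normalH,
      Matrix.cons_val, Fin.zero_eta, Fin.mk_one, Fin.reduceFinMk, totalDeriv_add, totalDeriv_sub,
      totalDeriv_neg, totalDeriv_ofNat_mul, totalDeriv_zero, totalDeriv_C_eq_lin, totalDeriv_lin,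
      jetDeriv_add, jetDeriv_sub, jetDeriv_neg, jetDeriv_ofNat_mul, jetDeriv_zero_right,
      jetDeriv_zero_C, jetDeriv_zero_lin, jetDeriv_one_lin, jetDeriv_zero_quad, jetDeriv_one_quad,
      jetDeriv_two_quad, totalDeriv_mul, zero_mul, mul_zero, add_zero, zero_add, sub_zero,
      neg_zero, one_mul, neg_neg, neg_mul, C_0]
    try simp only [quad, lin, Matrix.cons_val, totalDeriv_add, totalDeriv_mul, totalDeriv_sub,
      totalDeriv_neg, totalDeriv_zero, totalDeriv_X, totalDeriv_C, totalDeriv_ofNat,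
      Fin.sum_univ_three, pow_two, map_add, map_mul, map_ofNat, map_sub, map_neg, map_zero,
      pd_add, pd_sub, pd_neg, pd_zero, pd_ofNat_mul, pd_comm 1 0, pd_comm 2 0, pd_comm 2 1]
    try ring

set_option maxHeartbeats 40000000 in
/-- The part of `[P₀, Q]` with derivatives of delta functions vanishes for the normal form. -/
theorem normalBracketCoeff_eq_zero (a r s b11 b21 b22 : Smooth U) (i j k : Fin 3) :
    let c := skewBracketCoeff (normalA a) (normalB a r s b11 b21 b22) (normalL r s b21)
      (normalG r s b21) (normalH a r s b11 b21 b22) i j k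
    c 3 0 = 0 ∧ c 2 0 = 0 ∧ c 1 0 = 0 ∧ c 2 1 = 0 ∧ c 1 2 = 0 ∧ c 0 3 = 0 ∧ c 1 1 = 0 ∧
      c 0 2 = 0 ∧ c 0 1 = 0 := by
  refine ⟨?_, ?_, ?_, ?_, ?_, ?_, ?_, ?_, ?_⟩ <;>
  fin_cases i <;> fin_cases j <;> fin_cases k <;>
  · simp only [skewBracketCoeff, bracketCoeff, cyclicCoeff, halfCoeff, skewCoeffTwo, skewCoeffOne,
      skewCoeffZero, orient, hamDeriv, normalA, normalB, normalL, normalG, normalH,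
      Matrix.cons_val, Fin.zero_eta, Fin.mk_one, Fin.reduceFinMk, totalDeriv_add, totalDeriv_sub,
      totalDeriv_neg, totalDeriv_ofNat_mul, totalDeriv_zero, totalDeriv_C_eq_lin, totalDeriv_lin,
      jetDeriv_add, jetDeriv_sub, jetDeriv_neg, jetDeriv_ofNat_mul, jetDeriv_zero_right,
      jetDeriv_zero_C, jetDeriv_zero_lin, jetDeriv_one_lin, jetDeriv_one_quad, jetDeriv_two_quad,
      totalDeriv_mul, zero_mul, mul_zero, add_zero, zero_add, sub_zero, neg_zero, one_mul,
      neg_neg, neg_mul, C_0]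
    try simp only [quad, lin, Matrix.cons_val, totalDeriv_X, pow_two, map_add, map_mul, map_ofNat,
      map_sub, map_neg, map_zero, pd_add, pd_sub, pd_neg, pd_zero, pd_ofNat_mul, pd_comm 1 0,
      pd_comm 2 0, pd_comm 2 1]
    try ring

/-- `P₀` and every normal form commute. The parameters are halved or quartered to apply
`normalForm_eq_skewBivector`. -/
theorem schouten_rankZero_normalForm (a r s b11 b21 b22 : Smooth U) (i j k : Fin 3) :
    schouten (rankZero U) (normalForm a r s b11 b21 b22) i j k = 0 := by
  have h2 : ∀ f : Smooth U, 2 * ((1 / 2 : ℝ) • f) = f := fun f => by algebra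
  have h4 : ∀ f : Smooth U, 4 * ((1 / 4 : ℝ) • f) = f := fun f => by algebra
  rw [← h2 a, ← h4 r, ← h4 s, ← h4 b11, ← h4 b21, ← h4 b22, normalForm_eq_skewBivector,
    skewBivector, skewOp, schouten_rankZero_secondOrder (isHomog_skewCoeffTwo _)
    (isHomog_skewCoeffOne _ _ _) (isHomog_skewCoeffZero _ _ _ _ _)]
  obtain ⟨h30, h20, h10, h21, h12, h03, h11, h02, h01⟩ :=
    normalBracketCoeff_eq_zero ((1 / 2 : ℝ) • a) ((1 / 4 : ℝ) • r) ((1 / 4 : ℝ) • s)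
      ((1 / 4 : ℝ) • b11) ((1 / 4 : ℝ) • b21) ((1 / 4 : ℝ) • b22) i j k
  have h00 := normalBracketCoeff_zero_zero ((1 / 2 : ℝ) • a) ((1 / 4 : ℝ) • r) ((1 / 4 : ℝ) • s)
    ((1 / 4 : ℝ) • b11) ((1 / 4 : ℝ) • b21) ((1 / 4 : ℝ) • b22) i j k
  simp only [skewBracketCoeff] at h30 h20 h10 h21 h12 h03 h11 h02 h01 h00
  rw [h30, h20, h10, h21, h12, h03, h11, h02, h01, h00]
  simp

/-- `P₀` is a Poisson structure. -/
theorem schouten_rankZero_rankZero (i j k : Fin 3) :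
    schouten (rankZero U) (rankZero U) i j k = 0 := by
  have h : ∀ i j k, schoutenTerm (rankZero U) (rankZero U) i j k = 0 := fun i j k => by
    rw [schoutenTerm, rankZero_eq, Polynomial.sum_C_index (by simp [jetDeriv_zero_right])]
    refine Finset.sum_eq_zero fun l _ => Finset.sum_eq_zero fun s _ => ?_
    rw [jetDeriv_orient_mul]
    split_ifs with hl
    · have h0 : rankZero U l k = 0 := by
        rw [hl.1, rankZero_eq]
        fin_cases k <;> simp [orient]
      rw [h0, Function.iterate_fixed dx₂_zero, Polynomial.sum_zero_index, mul_zero]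
    · simp
  have hZ : atZXY (0 : Kernel₃ U) = 0 := map_zero (AddMonoidHom.mk' atZXY atZXY_add)
  have hY : atYZX (0 : Kernel₃ U) = 0 := map_zero (AddMonoidHom.mk' atYZX atYZX_add)
  simp only [schouten, h, add_zero, hZ, hY]

theorem hasDegree_rankZero : HasDegree (rankZero U) 1 := by
  intro i j m
  rw [rankZero_eq]
  rcases m with _ | m
  · simpa using isHomog_orient_mul i j
  · simpa [Polynomial.coeff_C] using fun _ => isHomog_zero _

theorem isSkew_rankZero : IsSkew (rankZero U) := by
  have h : rankZero U = secondOrder (fun _ _ => 0) (fun _ _ => 0)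
      (fun i j => orient i j * X (2, 0)) := by
    funext i j
    rw [rankZero_eq, secondOrder_apply]
    simp
  rw [h, isSkew_secondOrder_iff]
  intro i j
  fin_cases i <;> fin_cases j <;> simp [orient, totalDeriv_zero]

/-- `P₀ + ε P₁` is a first-order deformation for every normal form `P₁`, with no condition on the
parameters. -/
theorem isDeformation_normalForm (a r s b11 b21 b22 : Smooth U) :
    IsDeformation 1 (rankZero U) (affineSeries (rankZero U) (normalForm a r s b11 b21 b22)) := by
  refine ⟨rfl, fun m => ?_, fun m hm i j k => ?_⟩
  · rcases m with _ | _ | m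
    · exact ⟨hasDegree_rankZero, isSkew_rankZero⟩
    · have h2 : ∀ f : Smooth U, 2 * ((1 / 2 : ℝ) • f) = f := fun f => by algebra
      have h4 : ∀ f : Smooth U, 4 * ((1 / 4 : ℝ) • f) = f := fun f => by algebra
      change HasDegree (normalForm a r s b11 b21 b22) 2 ∧ IsSkew (normalForm a r s b11 b21 b22)
      rw [← h2 a, ← h4 r, ← h4 s, ← h4 b11, ← h4 b21, ← h4 b22, normalForm_eq_skewBivector]
      exact ⟨hasDegree_skewBivector _ _ _ _ _, isSkew_skewOp _ _ _ _⟩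
    · refine ⟨fun i j l => ⟨fun _ => ?_, fun _ => ?_⟩, fun i j => ?_⟩
      · exact isHomog_zero _
      · exact Polynomial.coeff_zero _
      · simp [affineSeries, swapXY]
  · interval_cases m
    · simpa [affineSeries] using schouten_rankZero_rankZero i j k
    · rw [Finset.Nat.antidiagonal_succ]
      simp [affineSeries, schouten_rankZero_normalForm,
        schouten_comm (normalForm a r s b11 b21 b22)]

end Cocycle

/-! ### The equations satisfied by a cocycle -/

section Equations

open MvPolynomial

set_option linter.unusedSimpArgs false

variable {U : Opens (Fin 3 → ℝ)} {A : Fin 3 → Smooth U} {B L G : Fin 3 → Fin 3 → Smooth U}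
  {H : Fin 3 → Fin 3 → Fin 3 → Smooth U}

/-- The coefficient of `u^k_x` is the value at the jet with `u^k_x = 1`. -/
theorem eq_zero_of_lin_eq_zero {b : Fin 3 → Smooth U} (h : lin b = 0) (k : Fin 3) : b k = 0 := by
  have e := congrArg (eval (Pi.single (k, 0) 1)) h
  fin_cases k <;> simpa [lin, Pi.single_apply] using e

/-- The coefficients are values at jets with one or two jet variables equal to `1`. -/
theorem eq_zero_of_quad_eq_zero {g : Fin 3 → Smooth U} {h : Fin 3 → Fin 3 → Smooth U}
    (hq : quad g h = 0) : (∀ k, g k = 0) ∧ h 0 0 = 0 ∧ h 0 1 = 0 ∧ h 0 2 = 0 ∧ h 1 1 = 0 ∧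
      h 1 2 = 0 ∧ h 2 2 = 0 := by
  have hg : ∀ k, g k = 0 := fun k => by
    have e := congrArg (eval (Pi.single (k, 1) 1)) hq
    fin_cases k <;> simpa [quad, Pi.single_apply] using e
  have hd : ∀ k, h k k = 0 := fun k => by
    have e := congrArg (eval (Pi.single (k, 0) 1)) hq
    fin_cases k <;> simpa [quad, Pi.single_apply] using e
  have ho : ∀ k l, k < l → h k l = 0 := fun k l hkl => by
    have e := congrArg (eval (Pi.single (k, 0) 1 + Pi.single (l, 0) 1)) hq
    clear hq
    fin_cases k <;> fin_cases l <;> simp_all [quad, Pi.single_apply]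
  exact ⟨hg, hd 0, ho 0 1 (by decide), ho 0 2 (by decide), hd 1, ho 1 2 (by decide), hd 2⟩

/-! In the names below, the digits are the (zero-based) indices `(i, j, k)` of the component
`[P₀, Q]^{ijk}` that is used, and the order is the number `a` of derivatives in
`δ^{(a)}(x-y) δ(x-z)`. -/

theorem cocycle_third_order (h : skewBracketCoeff A B L G H 1 0 0 3 0 = 0)
    (h' : skewBracketCoeff A B L G H 0 1 1 3 0 = 0) : A 1 = 0 ∧ A 2 = 0 := by
  simp only [skewBracketCoeff, bracketCoeff, cyclicCoeff, halfCoeff, skewCoeffTwo, orient,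
    Matrix.cons_val] at h h'
  have e := congrArg (eval 0) h
  have e' := congrArg (eval 0) h'
  simp at e e'
  exact ⟨e, e'⟩

theorem cocycle_second_order_010 (A1 : A 1 = 0) (A2 : A 2 = 0)
    (h : skewBracketCoeff A B L G H 0 1 0 2 0 = 0) :
    L 1 0 = 0 ∧ L 1 1 = 0 ∧ pd 1 (A 0) - L 1 2 - G 0 1 - B 0 0 = 0 := by
  have key : skewBracketCoeff A B L G H 0 1 0 2 0
      = lin ![-L 1 0, -L 1 1, pd 1 (A 0) - L 1 2 - G 0 1 - B 0 0] := by
    simp only [skewBracketCoeff, bracketCoeff, cyclicCoeff, halfCoeff, skewCoeffTwo, skewCoeffOne,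
      skewCoeffZero, orient, hamDeriv, Matrix.cons_val, totalDeriv_add, totalDeriv_sub,
      totalDeriv_neg, totalDeriv_ofNat_mul, totalDeriv_zero, totalDeriv_C_eq_lin, totalDeriv_lin,
      jetDeriv_add, jetDeriv_sub, jetDeriv_neg, jetDeriv_ofNat_mul, jetDeriv_zero_right,
      jetDeriv_zero_C, jetDeriv_zero_lin, jetDeriv_one_lin, jetDeriv_zero_quad, jetDeriv_one_quad,
      jetDeriv_two_quad, totalDeriv_mul, zero_mul, mul_zero, add_zero, zero_add, sub_zero,
      neg_zero, one_mul, neg_neg, neg_mul, C_0, A1, A2]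
    simp only [quad, lin, Matrix.cons_val, totalDeriv_add, totalDeriv_mul, totalDeriv_sub,
      totalDeriv_neg, totalDeriv_zero, totalDeriv_X, totalDeriv_C, totalDeriv_ofNat,
      Fin.sum_univ_three, pow_two, pd_zero, C_0, mul_zero, zero_mul, add_zero, zero_add, map_add,
      map_sub, map_neg, map_mul, map_ofNat, pd_add, pd_neg, pd_sub, pd_ofNat_mul, pd_comm 1 0,
      pd_comm 2 0, pd_comm 2 1, A1, A2]
    ring
  have e := eq_zero_of_lin_eq_zero (key.symm.trans h)
  exact ⟨neg_eq_zero.1 (e 0), neg_eq_zero.1 (e 1), e 2⟩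

theorem cocycle_second_order_011 (A1 : A 1 = 0) (A2 : A 2 = 0)
    (h : skewBracketCoeff A B L G H 0 1 1 2 0 = 0) :
    L 2 0 = 0 ∧ L 2 1 = 0 ∧ G 0 0 - L 0 0 - L 2 2 - B 1 1 = 0 := by
  have key : skewBracketCoeff A B L G H 0 1 1 2 0
      = lin ![-L 2 0, -L 2 1, G 0 0 - L 0 0 - L 2 2 - B 1 1] := by
    simp only [skewBracketCoeff, bracketCoeff, cyclicCoeff, halfCoeff, skewCoeffTwo, skewCoeffOne,
      skewCoeffZero, orient, hamDeriv, Matrix.cons_val, totalDeriv_add, totalDeriv_sub,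
      totalDeriv_neg, totalDeriv_ofNat_mul, totalDeriv_zero, totalDeriv_C_eq_lin, totalDeriv_lin,
      jetDeriv_add, jetDeriv_sub, jetDeriv_neg, jetDeriv_ofNat_mul, jetDeriv_zero_right,
      jetDeriv_zero_C, jetDeriv_zero_lin, jetDeriv_one_lin, jetDeriv_zero_quad, jetDeriv_one_quad,
      jetDeriv_two_quad, totalDeriv_mul, zero_mul, mul_zero, add_zero, zero_add, sub_zero,
      neg_zero, one_mul, neg_neg, neg_mul, C_0, A1, A2]
    simp only [quad, lin, Matrix.cons_val, totalDeriv_add, totalDeriv_mul, totalDeriv_sub,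
      totalDeriv_neg, totalDeriv_zero, totalDeriv_X, totalDeriv_C, totalDeriv_ofNat,
      Fin.sum_univ_three, pow_two, pd_zero, C_0, mul_zero, zero_mul, add_zero, zero_add, map_add,
      map_sub, map_neg, map_mul, map_ofNat, pd_add, pd_neg, pd_sub, pd_ofNat_mul, pd_comm 1 0,
      pd_comm 2 0, pd_comm 2 1, A1, A2]
    ring
  have e := eq_zero_of_lin_eq_zero (key.symm.trans h)
  exact ⟨neg_eq_zero.1 (e 0), neg_eq_zero.1 (e 1), e 2⟩

set_option maxHeartbeats 2000000 in
theorem cocycle_first_order_100 (A1 : A 1 = 0) (A2 : A 2 = 0) (L10 : L 1 0 = 0)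
    (L11 : L 1 1 = 0) (L20 : L 2 0 = 0) (L21 : L 2 1 = 0)
    (h : skewBracketCoeff A B L G H 1 0 0 1 0 = 0) :
    (G 1 0 = 0 ∧ G 1 1 = 0 ∧ H 1 0 0 = 0 ∧ H 1 0 1 = 0 ∧ H 1 1 1 = 0) ∧
      2 * G 0 1 + G 1 2 + L 1 2 - L 0 1 = 0 ∧
      H 0 0 1 + H 1 0 2 + pd 0 (L 1 2) - pd 1 (L 0 0) = 0 ∧
      2 * H 0 1 1 + H 1 1 2 + pd 1 (L 1 2) - pd 1 (L 0 1) + pd 1 (B 0 0) - pd 0 (B 0 1) = 0 ∧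
      H 0 1 2 + H 1 2 2 + pd 2 (L 1 2) - pd 1 (L 0 2) + pd 2 (B 0 0) - pd 0 (B 0 2) = 0 := by
  have key : skewBracketCoeff A B L G H 1 0 0 1 0
      = quad ![G 1 0, G 1 1, 2 * G 0 1 + G 1 2 + L 1 2 - L 0 1]
        ![![H 1 0 0, H 1 0 1, H 0 0 1 + H 1 0 2 + pd 0 (L 1 2) - pd 1 (L 0 0)],
          ![0, H 1 1 1, 2 * H 0 1 1 + H 1 1 2 + pd 1 (L 1 2) - pd 1 (L 0 1) + pd 1 (B 0 0)
              - pd 0 (B 0 1)],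
          ![0, 0, H 0 1 2 + H 1 2 2 + pd 2 (L 1 2) - pd 1 (L 0 2) + pd 2 (B 0 0)
              - pd 0 (B 0 2)]] := by
    simp only [skewBracketCoeff, bracketCoeff, cyclicCoeff, halfCoeff, skewCoeffTwo, skewCoeffOne,
      skewCoeffZero, orient, hamDeriv, Matrix.cons_val, totalDeriv_add, totalDeriv_sub,
      totalDeriv_neg, totalDeriv_ofNat_mul, totalDeriv_zero, totalDeriv_C_eq_lin, totalDeriv_lin,
      jetDeriv_add, jetDeriv_sub, jetDeriv_neg, jetDeriv_ofNat_mul, jetDeriv_zero_right,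
      jetDeriv_zero_C, jetDeriv_zero_lin, jetDeriv_one_lin, jetDeriv_zero_quad, jetDeriv_one_quad,
      jetDeriv_two_quad, totalDeriv_mul, zero_mul, mul_zero, add_zero, zero_add, sub_zero,
      neg_zero, one_mul, neg_neg, neg_mul, C_0, A1, A2, L10, L11, L20, L21]
    simp only [quad, lin, Matrix.cons_val, totalDeriv_add, totalDeriv_mul, totalDeriv_sub,
      totalDeriv_neg, totalDeriv_zero, totalDeriv_X, totalDeriv_C, totalDeriv_ofNat,
      Fin.sum_univ_three, pow_two, pd_zero, C_0, mul_zero, zero_mul, add_zero, zero_add, map_add,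
      map_sub, map_neg, map_mul, map_ofNat, pd_add, pd_neg, pd_sub, pd_ofNat_mul, pd_comm 1 0,
      pd_comm 2 0, pd_comm 2 1, A1, A2, L10, L11, L20, L21]
    ring
  obtain ⟨eg, e00, e01, e02, e11, e12, e22⟩ := eq_zero_of_quad_eq_zero (key.symm.trans h)
  exact ⟨⟨eg 0, eg 1, e00, e01, e11⟩, eg 2, e02, e12, e22⟩

set_option maxHeartbeats 2000000 in
theorem cocycle_first_order_101 (A1 : A 1 = 0) (A2 : A 2 = 0) (L10 : L 1 0 = 0)
    (L11 : L 1 1 = 0) (L20 : L 2 0 = 0) (L21 : L 2 1 = 0)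
    (h : skewBracketCoeff A B L G H 1 0 1 1 0 = 0) :
    (G 2 0 = 0 ∧ G 2 1 = 0 ∧ H 2 0 0 = 0 ∧ H 2 0 1 = 0 ∧ H 2 1 1 = 0) ∧
      L 0 0 + L 2 2 - G 2 2 + 2 * B 1 1 = 0 ∧
      2 * H 0 0 0 - H 2 0 2 + pd 0 (L 0 0) + pd 0 (L 2 2) - 2 * pd 0 (G 0 0) + pd 1 (B 1 0)
        + pd 0 (B 1 1) = 0 ∧
      H 0 0 1 - H 2 1 2 + pd 1 (L 0 0) + pd 1 (L 2 2) - 2 * pd 1 (G 0 0) + 2 * pd 1 (B 1 1) = 0 ∧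
      H 0 0 2 - H 2 2 2 + pd 2 (L 0 0) + pd 2 (L 2 2) - 2 * pd 2 (G 0 0) + pd 2 (B 1 1)
        + pd 1 (B 1 2) = 0 := by
  have key : skewBracketCoeff A B L G H 1 0 1 1 0
      = quad ![-G 2 0, -G 2 1, L 0 0 + L 2 2 - G 2 2 + 2 * B 1 1]
        ![![-H 2 0 0, -H 2 0 1, 2 * H 0 0 0 - H 2 0 2 + pd 0 (L 0 0) + pd 0 (L 2 2)
              - 2 * pd 0 (G 0 0) + pd 1 (B 1 0) + pd 0 (B 1 1)],
          ![0, -H 2 1 1, H 0 0 1 - H 2 1 2 + pd 1 (L 0 0) + pd 1 (L 2 2) - 2 * pd 1 (G 0 0)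
              + 2 * pd 1 (B 1 1)],
          ![0, 0, H 0 0 2 - H 2 2 2 + pd 2 (L 0 0) + pd 2 (L 2 2) - 2 * pd 2 (G 0 0)
              + pd 2 (B 1 1) + pd 1 (B 1 2)]] := by
    simp only [skewBracketCoeff, bracketCoeff, cyclicCoeff, halfCoeff, skewCoeffTwo, skewCoeffOne,
      skewCoeffZero, orient, hamDeriv, Matrix.cons_val, totalDeriv_add, totalDeriv_sub,
      totalDeriv_neg, totalDeriv_ofNat_mul, totalDeriv_zero, totalDeriv_C_eq_lin, totalDeriv_lin,
      jetDeriv_add, jetDeriv_sub, jetDeriv_neg, jetDeriv_ofNat_mul, jetDeriv_zero_right,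
      jetDeriv_zero_C, jetDeriv_zero_lin, jetDeriv_one_lin, jetDeriv_zero_quad, jetDeriv_one_quad,
      jetDeriv_two_quad, totalDeriv_mul, zero_mul, mul_zero, add_zero, zero_add, sub_zero,
      neg_zero, one_mul, neg_neg, neg_mul, C_0, A1, A2, L10, L11, L20, L21]
    simp only [quad, lin, Matrix.cons_val, totalDeriv_add, totalDeriv_mul, totalDeriv_sub,
      totalDeriv_neg, totalDeriv_zero, totalDeriv_X, totalDeriv_C, totalDeriv_ofNat,
      Fin.sum_univ_three, pow_two, pd_zero, C_0, mul_zero, zero_mul, add_zero, zero_add, map_add,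
      map_sub, map_neg, map_mul, map_ofNat, pd_add, pd_neg, pd_sub, pd_ofNat_mul, pd_comm 1 0,
      pd_comm 2 0, pd_comm 2 1, A1, A2, L10, L11, L20, L21]
    ring
  obtain ⟨eg, e00, e01, e02, e11, e12, e22⟩ := eq_zero_of_quad_eq_zero (key.symm.trans h)
  exact ⟨⟨neg_eq_zero.1 (eg 0), neg_eq_zero.1 (eg 1), neg_eq_zero.1 e00, neg_eq_zero.1 e01,
    neg_eq_zero.1 e11⟩, eg 2, e02, e12, e22⟩

/-- Three components with an index `3`, of which only the monomial `(u³_x)²` is used. -/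
theorem cocycle_first_order_third (A1 : A 1 = 0) (A2 : A 2 = 0) (L1 : L 1 0 = 0 ∧ L 1 1 = 0)
    (L2 : L 2 0 = 0 ∧ L 2 1 = 0)
    (h1 : G 1 0 = 0 ∧ G 1 1 = 0 ∧ H 1 0 0 = 0 ∧ H 1 0 1 = 0 ∧ H 1 1 1 = 0)
    (h2 : G 2 0 = 0 ∧ G 2 1 = 0 ∧ H 2 0 0 = 0 ∧ H 2 0 1 = 0 ∧ H 2 1 1 = 0)
    (h : skewBracketCoeff A B L G H 2 0 0 1 0 = 0)
    (h' : skewBracketCoeff A B L G H 2 1 1 1 0 = 0)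
    (h'' : skewBracketCoeff A B L G H 1 0 2 1 0 = 0) :
    H 1 1 2 = pd 1 (L 1 2) ∧ H 2 0 2 = pd 0 (L 2 2) ∧
      pd 1 (L 2 2) - pd 0 (L 1 2) + H 1 0 2 - H 2 1 2 = 0 := by
  simp only [skewBracketCoeff, bracketCoeff, cyclicCoeff, halfCoeff, skewCoeffTwo, skewCoeffOne,
    skewCoeffZero, orient, hamDeriv, Matrix.cons_val, totalDeriv_add, totalDeriv_sub,
    totalDeriv_neg, totalDeriv_ofNat_mul, totalDeriv_zero, totalDeriv_C_eq_lin, totalDeriv_lin,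
    jetDeriv_add, jetDeriv_sub, jetDeriv_neg, jetDeriv_ofNat_mul, jetDeriv_zero_right,
    jetDeriv_zero_C, jetDeriv_zero_lin, jetDeriv_one_lin, jetDeriv_zero_quad, jetDeriv_one_quad,
    jetDeriv_two_quad, totalDeriv_mul, zero_mul, mul_zero, add_zero, zero_add, sub_zero, neg_zero,
    one_mul, neg_neg, neg_mul, C_0, A1, A2, L1, L2, h1, h2] at h h' h''
  simp only [quad, lin, Matrix.cons_val, totalDeriv_add, totalDeriv_mul, totalDeriv_sub,
    totalDeriv_neg, totalDeriv_zero, totalDeriv_X, totalDeriv_C, totalDeriv_ofNat,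
    Fin.sum_univ_three, pow_two, pd_zero, C_0, mul_zero, zero_mul, add_zero, zero_add, A1, A2, L1,
    L2, h1, h2] at h h' h''
  have e := congrArg (eval (Pi.single (2, 0) 1)) h
  have e' := congrArg (eval (Pi.single (2, 0) 1)) h'
  have e'' := congrArg (eval (Pi.single (2, 0) 1)) h''
  simp [Pi.single_apply] at e e' e''
  exact ⟨by linear_combination e, by linear_combination -e', by linear_combination e''⟩

set_option maxHeartbeats 1000000 in
/-- The two divergence equations come from the monomials `(u³_x)³` and `u³_x u³_{xx}`. They become
equations for divergences once `H 1 0 2` and `H 2 1 2` are known. -/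
theorem cocycle_zeroth_order (A1 : A 1 = 0) (A2 : A 2 = 0) (L1 : L 1 0 = 0 ∧ L 1 1 = 0)
    (L2 : L 2 0 = 0 ∧ L 2 1 = 0)
    (h1 : G 1 0 = 0 ∧ G 1 1 = 0 ∧ H 1 0 0 = 0 ∧ H 1 0 1 = 0 ∧ H 1 1 1 = 0)
    (h2 : G 2 0 = 0 ∧ G 2 1 = 0 ∧ H 2 0 0 = 0 ∧ H 2 0 1 = 0 ∧ H 2 1 1 = 0)
    (h : skewBracketCoeff A B L G H 0 1 2 0 0 = 0) :
    (∀ k, B 2 k = 0) ∧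
      pd 0 (G 1 2) + pd 1 (G 2 2) + H 1 0 2 - 2 * pd 0 (L 1 2) - H 2 1 2 = 0 ∧
      pd 0 (H 1 2 2) + pd 1 (H 2 2 2) - pd 2 (pd 0 (L 1 2)) - pd 2 (H 2 1 2) = 0 := by
  simp only [skewBracketCoeff, bracketCoeff, cyclicCoeff, halfCoeff, skewCoeffTwo, skewCoeffOne,
    skewCoeffZero, orient, hamDeriv, Matrix.cons_val, totalDeriv_add, totalDeriv_sub,
    totalDeriv_neg, totalDeriv_ofNat_mul, totalDeriv_zero, totalDeriv_C_eq_lin, totalDeriv_lin,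
    jetDeriv_add, jetDeriv_sub, jetDeriv_neg, jetDeriv_ofNat_mul, jetDeriv_zero_right,
    jetDeriv_zero_C, jetDeriv_zero_lin, jetDeriv_one_lin, jetDeriv_zero_quad, jetDeriv_one_quad,
    jetDeriv_two_quad, totalDeriv_mul, zero_mul, mul_zero, add_zero, zero_add, sub_zero, neg_zero,
    one_mul, neg_neg, neg_mul, C_0, A1, A2, L1, L2, h1, h2] at h
  simp only [quad, lin, Matrix.cons_val, totalDeriv_add, totalDeriv_mul, totalDeriv_sub,
    totalDeriv_neg, totalDeriv_zero, totalDeriv_X, totalDeriv_C, totalDeriv_ofNat,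
    Fin.sum_univ_three, pow_two, pd_zero, C_0, mul_zero, zero_mul, add_zero, zero_add, A1, A2, L1,
    L2, h1, h2] at h
  have ez : ∀ k, B 2 k = 0 := fun k => by
    have e := congrArg (eval (Pi.single (k, 2) 1)) h
    fin_cases k <;> simpa [Pi.single_apply] using e
  -- At the jet `u³_x = 1` only `(u³_x)³` survives; at `u³_x = u³_{xx} = 1` only `(u³_x)³` and
  -- `u³_x u³_{xx}` do.
  have e := congrArg (eval (Pi.single (2, 0) 1)) h
  have e' := congrArg (eval (Pi.single (2, 0) 1 + Pi.single (2, 1) 1)) h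
  simp [Pi.single_apply, ez, pd_zero] at e e'
  rw [pd_comm 2 1] at e e'
  exact ⟨ez, by linear_combination e' - e, by linear_combination e⟩

end Equations

/-! ### Reduction of a cocycle to the normal form -/

section Reduction

open MvPolynomial

variable {U : Opens (Fin 3 → ℝ)}

/-- Only the entries of `H` on and above the diagonal enter a bivector. -/
theorem skewBivector_congr {A A' : Fin 3 → Smooth U} {B L G B' L' G' : Fin 3 → Fin 3 → Smooth U}
    {H H' : Fin 3 → Fin 3 → Fin 3 → Smooth U} (hA : ∀ e, A e = A' e) (hB : ∀ i k, B i k = B' i k)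
    (hL : ∀ e k, L e k = L' e k) (hG : ∀ e k, G e k = G' e k)
    (hH : ∀ e k l, k ≤ l → H e k l = H' e k l) :
    skewBivector A B L G H = skewBivector A' B' L' G' H' := by
  obtain rfl : A = A' := funext hA
  obtain rfl : B = B' := funext fun i => funext (hB i)
  obtain rfl : L = L' := funext fun e => funext (hL e)
  obtain rfl : G = G' := funext fun e => funext (hG e)
  have hQ : (fun e => quad (G e) (H e)) = fun e => quad (G e) (H' e) := by
    funext e
    simp only [quad, hH e 0 0 (by decide), hH e 0 1 (by decide), hH e 0 2 (by decide),
      hH e 1 1 (by decide), hH e 1 2 (by decide), hH e 2 2 (by decide)]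
  rw [skewBivector, skewBivector, hQ]

set_option maxHeartbeats 2000000 in
/-- Every cocycle of degree two is cohomologous to a normal form, along a field of degree one. -/
theorem exists_add_lieDeriv_eq_normalForm (hU : IsOpenBox U) {P : BivectorKernel U}
    (hd : HasDegree P 2) (hs : IsSkew P)
    (hP : ∀ i j k, schouten (rankZero U) P i j k = 0) :
    ∃ (ξ : Fin 3 → Fin 3 → Smooth U) (a r s b11 b21 b22 : Smooth U),
      P + lieDeriv (fun k => lin (ξ k)) (rankZero U) = normalForm a r s b11 b21 b22 := by
  obtain ⟨A, B, L, G, H, rfl⟩ := exists_eq_skewBivector hd hs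
  have hc : ∀ i j k, skewBracketCoeff A B L G H i j k 3 0 = 0 ∧
      skewBracketCoeff A B L G H i j k 2 0 = 0 ∧ skewBracketCoeff A B L G H i j k 1 0 = 0 ∧
      skewBracketCoeff A B L G H i j k 0 0 = 0 := fun i j k =>
    bracketCoeff_eq_zero (isHomog_skewCoeffTwo _) (isHomog_skewCoeffOne _ _ _)
      (isHomog_skewCoeffZero _ _ _ _ _) (hP i j k)
  obtain ⟨A1, A2⟩ := cocycle_third_order (hc 1 0 0).1 (hc 0 1 1).1
  obtain ⟨L10, L11, E1⟩ := cocycle_second_order_010 A1 A2 (hc 0 1 0).2.1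
  obtain ⟨L20, L21, E2⟩ := cocycle_second_order_011 A1 A2 (hc 0 1 1).2.1
  obtain ⟨Z1, E6, E3, E4, E5⟩ :=
    cocycle_first_order_100 A1 A2 L10 L11 L20 L21 (hc 1 0 0).2.2.1
  obtain ⟨Z2, E10, E7, E8, E9⟩ :=
    cocycle_first_order_101 A1 A2 L10 L11 L20 L21 (hc 1 0 1).2.2.1
  obtain ⟨H112, H202, E12⟩ := cocycle_first_order_third A1 A2 ⟨L10, L11⟩ ⟨L20, L21⟩ Z1 Z2
    (hc 2 0 0).2.2.1 (hc 2 1 1).2.2.1 (hc 1 0 2).2.2.1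
  obtain ⟨B2, E13, E14⟩ := cocycle_zeroth_order A1 A2 ⟨L10, L11⟩ ⟨L20, L21⟩ Z1 Z2 (hc 0 1 2).2.2.2
  obtain ⟨G10, G11, H100, H101, H111⟩ := Z1
  obtain ⟨G20, G21, H200, H201, H211⟩ := Z2
  -- Elimination of `H 0 0 1` and `G 0 0` expresses `H 2 1 2` and `H 1 0 2` by derivatives of `L`,
  -- which turns the two equations of order zero into divergence equations.
  have E2' := congrArg (pd 1) E2
  simp only [pd_sub, pd_zero] at E2'
  have H212 : H 2 1 2 = -pd 0 (L 1 2) := by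
    linear_combination (norm := algebra)
      (1 / 2 : ℝ) • (E3 - E8 - E12) - E2'
  have H102 : H 1 0 2 = -pd 1 (L 2 2) := by
    linear_combination E12 + H212
  -- `φ` is the potential of the coefficients of `u³_{xx}` in the entries `(3,1)` and `(3,2)`, after
  -- subtraction of `L`, and `ψ` that of the coefficients of `(u³_x)²`; `φ = s + r` in the normal
  -- form with parameters `4r, 4s`.
  obtain ⟨φ, hφ1, hφ0⟩ := hU.exists_potential ((1 / 4 : ℝ) • (L 1 2 - G 1 2))
    ((1 / 4 : ℝ) • (L 2 2 - G 2 2)) (by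
      simp only [pd_smul, pd_sub]
      linear_combination (norm := algebra) (1 / 4 : ℝ) • (E12 - E13))
  obtain ⟨ψ, hψ1, hψ0⟩ := hU.exists_potential (H 1 2 2) (H 2 2 2) (by
    have h := congrArg (pd 2) H212
    rw [pd_neg] at h
    linear_combination E14 + h)
  obtain ⟨r, hr, -⟩ := hU.exists_pd_eq 0 ((1 / 2 : ℝ) • B 1 1)
  have G12 : G 1 2 = L 1 2 - 4 * pd 1 φ := by rw [hφ1]; algebra
  have G22 : G 2 2 = L 2 2 + 4 * pd 0 φ := by rw [hφ0]; algebra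
  have B11 : B 1 1 = 2 * pd 0 r := by rw [hr]; algebra
  have H222 : H 2 2 2 = -pd 0 ψ := by rw [hψ0, neg_neg]
  have L01 : L 0 1 = 2 * G 0 1 + 2 * L 1 2 - 4 * pd 1 φ := by linear_combination G12 - E6
  have L00 : L 0 0 = 4 * pd 0 φ - 4 * pd 0 r := by linear_combination E10 + G22 - 2 * B11
  have G00 : G 0 0 = 4 * pd 0 φ - 2 * pd 0 r + L 2 2 := by linear_combination E2 + L00 + B11
  have B00 : B 0 0 = pd 1 (A 0) - L 1 2 - G 0 1 := by linear_combination -E1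
  have H001 : H 0 0 1 = pd 1 (L 0 0) + pd 1 (L 2 2) - pd 0 (L 1 2) := by
    linear_combination E3 - H102
  have H011 : H 0 1 1 = (1 / 2 : ℝ) • (pd 1 (L 0 1) - 2 * pd 1 (L 1 2) - pd 1 (B 0 0)
      + pd 0 (B 0 1)) := by
    linear_combination (norm := algebra) (1 / 2 : ℝ) • (E4 - H112)
  have H012 : H 0 1 2 = pd 1 (L 0 2) - pd 1 ψ - pd 2 (L 1 2) - pd 2 (B 0 0) + pd 0 (B 0 2) := by
    linear_combination E5 + hψ1
  have H000 : H 0 0 0 = (1 / 2 : ℝ) • (2 * pd 0 (G 0 0) - pd 0 (L 0 0) - pd 1 (B 1 0)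
      - pd 0 (B 1 1)) := by
    linear_combination (norm := algebra) (1 / 2 : ℝ) • (E7 + H202)
  have H002 : H 0 0 2 = 2 * pd 2 (G 0 0) - pd 0 ψ - pd 2 (L 0 0) - pd 2 (L 2 2) - pd 2 (B 1 1)
      - pd 1 (B 1 2) := by
    linear_combination E9 + H222
  -- The remaining freedom `ξ^1_3 = η` removes the coefficient of `(u³_x)²` in the entry `(2,1)`.
  obtain ⟨η, hη, -⟩ := hU.exists_pd_eq 0 (pd 2 (L 0 2 - ψ - G 0 2) - pd 2 ψ - H 0 2 2)
  -- `ξ^3_1`, `ξ^3_2` remove `u¹_{xx}`, `u²_{xx}` from the entry `(2,1)`, and `ξ^3_3 = -ψ` removes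
  -- `(u³_x)²` from the entries `(3,1)`, `(3,2)`; then `ξ^2_2` and `ξ^1_1` remove `u³_{xx}` and the
  -- first-order `u³_x` from the entry `(2,1)`, and `ξ^1_2`, `ξ^2_1` remove `u³_x` from the
  -- diagonal. The parameters carry the factors `2` and `4` of `normalForm_eq_skewBivector`.
  refine ⟨![![L 0 2 - ψ - G 0 2, -B 0 2, η], ![B 1 2, -ψ - G 0 2, 0], ![G 0 0, G 0 1, -ψ]],
    2 * ((1 / 2 : ℝ) • A 0), 4 * r, 4 * (φ - r), 4 * ((1 / 2 : ℝ) • B 0 1),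
    4 * ((1 / 4 : ℝ) • L 0 1), 4 * ((1 / 2 : ℝ) • B 1 0), ?_⟩
  rw [lieDeriv_rankZero_eq_skewBivector, skewBivector_add, normalForm_eq_skewBivector]
  refine skewBivector_congr (fun e => ?_) (fun i k => ?_) (fun e k => ?_) (fun e k => ?_)
    (fun e k l hkl => ?_)
  · fin_cases e <;>
    · simp only [normalA, A1, A2, Matrix.cons_val, Fin.zero_eta, Fin.mk_one, Fin.reduceFinMk,
        Pi.add_apply, Pi.zero_apply]
      algebra
  · fin_cases i <;> fin_cases k <;>
    · simp only [normalB, B2, B00, B11, L01, Matrix.cons_val, Fin.zero_eta, Fin.mk_one,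
        Fin.reduceFinMk, Pi.add_apply, Pi.zero_apply, pd_sub, pd_smul]
      algebra
  · fin_cases e <;> fin_cases k <;>
    · simp only [normalL, L00, L01, L10, L11, L20, L21, G00, Matrix.cons_val, Fin.zero_eta,
        Fin.mk_one, Fin.reduceFinMk, Pi.add_apply, pd_sub]
      algebra
  · fin_cases e <;> fin_cases k <;>
    · simp only [normalG, G00, G10, G11, G12, G20, G21, G22, L01, Matrix.cons_val, Fin.zero_eta,
        Fin.mk_one, Fin.reduceFinMk, Pi.add_apply, pd_sub]
      algebra
  · fin_cases e <;> fin_cases k <;> fin_cases l <;>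
    first
    | exact absurd hkl (by decide)
    | simp only [normalH, H000, H001, H002, H011, H012, H100, H101, H102, H111, H112, H200, H201,
        H202, H211, H212, H222, ← hψ1, hη, L00, L01, G00, B00, B11, Matrix.cons_val, Fin.zero_eta,
        Fin.mk_one, Fin.reduceFinMk, Pi.add_apply, pd_add, pd_sub, pd_neg, pd_smul, pd_zero,
        pd_ofNat_mul, pd_comm 1 0, pd_comm 2 0, pd_comm 2 1]
      algebra

/-- Every first-order deformation of `P₀` becomes `P₀ + ε P₁ + O(ε²)`, with `P₁` a normal form,
under an infinitesimal Miura transformation. -/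
theorem exists_miura_eq_normalForm (hU : IsOpenBox U) {P : ℕ → BivectorKernel U}
    (hP : IsDeformation 1 (rankZero U) P) :
    ∃ X : VField U, X.HasDegree 1 ∧ ∃ a r s b11 b21 b22 : Smooth U, ∀ m ≤ 1,
      miura X P m = affineSeries (rankZero U) (normalForm a r s b11 b21 b22) m := by
  obtain ⟨h0, hdeg, hP⟩ := hP
  have hbr : ∀ i j k, schouten (rankZero U) (P 1) i j k = 0 := fun i j k => by
    have h := hP 1 le_rfl i j k
    rw [Finset.Nat.antidiagonal_succ] at h
    simp only [Finset.Nat.antidiagonal_zero, Finset.map_singleton, Finset.sum_cons,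
      Finset.sum_singleton, Function.Embedding.prodMap, Function.Embedding.coeFn_mk, Prod.map,
      Nat.succ_eq_add_one, Function.Embedding.refl_apply, zero_add, h0, schouten_comm (P 1)] at h
    -- The order `ε` term of `[P_ε, P_ε]` is `2 [P₀, P₁]`.
    linear_combination (norm := algebra) (1 / 2 : ℝ) • h
  obtain ⟨ξ, a, r, s, b11, b21, b22, h⟩ :=
    exists_add_lieDeriv_eq_normalForm hU (hdeg 1).1 (hdeg 1).2 hbr
  refine ⟨fun k => lin (ξ k), fun k => isHomog_lin _, a, r, s, b11, b21, b22, fun m hm => ?_⟩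
  interval_cases m
  · simp [miura, affineSeries, h0]
  · rw [affineSeries, ← h, miura, Finset.Nat.antidiagonal_succ]
    simp [h0]

end Reduction

end PoissonDeformation

end

theorem theorem6 (U : TopologicalSpace.Opens (Fin 3 → ℝ))
    (hU : PoissonDeformation.IsOpenBox U) :
    (∀ P : ℕ → PoissonDeformation.BivectorKernel U,
      PoissonDeformation.IsDeformation 1 (PoissonDeformation.rankZero U) P →
      ∃ X : PoissonDeformation.VField U, PoissonDeformation.VField.HasDegree X 1 ∧
        ∃ a r s b11 b21 b22 : PoissonDeformation.Smooth U, ∀ m ≤ 1,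
          PoissonDeformation.miura X P m =
            PoissonDeformation.affineSeries (PoissonDeformation.rankZero U)
              (PoissonDeformation.normalForm a r s b11 b21 b22) m) ∧
    (∀ a r s b11 b21 b22 : PoissonDeformation.Smooth U,
      PoissonDeformation.IsDeformation 1 (PoissonDeformation.rankZero U)
        (PoissonDeformation.affineSeries (PoissonDeformation.rankZero U)
          (PoissonDeformation.normalForm a r s b11 b21 b22))) :=
  ⟨fun _ hP => PoissonDeformation.exists_miura_eq_normalForm hU hP,
    PoissonDeformation.isDeformation_normalForm⟩
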